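/- Let $(\Omega,\mathcal F,(\mathcal F_t)_{t\ge 0},\mathbb P)$ be a filtered probability space and $W$ a standard one-dimensional Brownian motion relative to $(\mathcal F_t)$. Let $\alpha,\mu\in\mathbb R$ with $\alpha\neq 0$ and $\mu<\alpha^2/2$, and let $x$ be a continuous adapted solution of the Itô equation $$dx=\mu x\,dt+\alpha x\,dW,\qquad x(0)=1 .$$ For $R>1$ put $\tau_R=\inf\{t\ge 0: x(t)>R\}$, with $\inf\emptyset=\infty$. Then $$\mathbb P(\tau_R=\infty)\;\ge\; 1-\left(\frac1R\right)^{1-\frac{2\mu}{\alpha^2}} .$$ -/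

import Mathlib

open MeasureTheory ProbabilityTheory Filter Topology
open scoped NNReal ENNReal

/-- `W` is a standard one-dimensional Brownian motion relative to the filtration `F`: it is a
Brownian motion with almost surely continuous paths, it is adapted to `F`, and for `s ≤ t` its
increment `W t - W s` is independent of `F s`. -/
structure IsBrownianMotionRel {Ω : Type*} {mΩ : MeasurableSpace Ω}
    (F : Filtration ℝ≥0 mΩ) (P : Measure Ω) (W : ℝ≥0 → Ω → ℝ) : Prop where
  isBrownian : IsBrownianReal W P
  adapted : Adapted F W
  indep_increment : ∀ s t : ℝ≥0, s ≤ t →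
    Indep (MeasurableSpace.comap (fun ω => W t ω - W s ω) inferInstance) (F s) P

/-- A simple (elementary predictable) process
`∑ i < n, ξ i * 1_{(t i, t (i + 1)]}`, where `t 0 ≤ t 1 ≤ ⋯` are deterministic times and every
`ξ i` is a bounded `F (t i)`-measurable random variable. -/
structure SimpleProcess {Ω : Type*} {mΩ : MeasurableSpace Ω} (F : Filtration ℝ≥0 mΩ) where
  n : ℕ
  t : ℕ → ℝ≥0
  mono : Monotone t
  ξ : ℕ → Ω → ℝ
  meas : ∀ i, Measurable[F (t i)] (ξ i)
  bdd : ∀ i, ∃ C : ℝ, ∀ ω, |ξ i ω| ≤ C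

/-- The value at time `s` of a simple process. -/
noncomputable def SimpleProcess.val {Ω : Type*} {mΩ : MeasurableSpace Ω}
    {F : Filtration ℝ≥0 mΩ} (S : SimpleProcess F) (s : ℝ≥0) (ω : Ω) : ℝ :=
  ∑ i ∈ Finset.range S.n, (Set.Ioc (S.t i) (S.t (i + 1))).indicator (fun _ => S.ξ i ω) s

/-- The stochastic integral up to time `s` of a simple process against `W`. -/
noncomputable def SimpleProcess.integral {Ω : Type*} {mΩ : MeasurableSpace Ω}
    {F : Filtration ℝ≥0 mΩ} (S : SimpleProcess F) (W : ℝ≥0 → Ω → ℝ) (s : ℝ≥0) (ω : Ω) : ℝ :=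
  ∑ i ∈ Finset.range S.n, S.ξ i ω * (W (min (S.t (i + 1)) s) ω - W (min (S.t i) s) ω)

/-- `Y t = ∫₀ᵗ H dW` is the Itô integral process of the integrand `H` against `W`: the integrand is
adapted with measurable paths, `Y` has continuous paths, and there are simple processes `S k` with
`∫₀ᵀ |S k - H|² ds → 0` in probability for every `T`, whose stochastic integrals up to time `t`
converge to `Y t` in probability for every `t`. In particular `H` is almost surely locally square
integrable; no moment condition on `H` is imposed. -/
structure IsItoIntegral {Ω : Type*} {mΩ : MeasurableSpace Ω} (F : Filtration ℝ≥0 mΩ)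
    (P : Measure Ω) (W H Y : ℝ≥0 → Ω → ℝ) : Prop where
  adapted : Adapted F H
  measurable_path : ∀ᵐ ω ∂P, Measurable fun s : ℝ≥0 => H s ω
  continuous_path : ∀ᵐ ω ∂P, Continuous fun t : ℝ≥0 => Y t ω
  approx : ∃ S : ℕ → SimpleProcess F,
    (∀ T : ℝ≥0, ∀ ε : ℝ≥0∞, 0 < ε → Tendsto
      (fun k => P {ω | ε ≤ ∫⁻ s in Set.Icc (0 : ℝ) T,
        ENNReal.ofReal (((S k).val s.toNNReal ω - H s.toNNReal ω) ^ 2)})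
      atTop (𝓝 0)) ∧
    (∀ t : ℝ≥0, TendstoInMeasure P (fun k => (S k).integral W t) atTop (Y t))

/-- `x` is a (global, pathwise) solution of the stochastic differential equation
`dx = b(x) dt + σ(x) dW`, `x(0) = x₀`, on the stochastic basis `(Ω, P, F, W)`: it is adapted with
continuous paths and almost surely, for all `t ≥ 0`,
`x(t) = x₀ + ∫₀ᵗ b(x(s)) ds + ∫₀ᵗ σ(x(s)) dW(s)`. -/
structure IsSDESolution {Ω : Type*} {mΩ : MeasurableSpace Ω} (F : Filtration ℝ≥0 mΩ)
    (P : Measure Ω) (W : ℝ≥0 → Ω → ℝ) (b σ : ℝ → ℝ) (x₀ : ℝ) (x : ℝ≥0 → Ω → ℝ) : Prop where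
  adapted : Adapted F x
  continuous_path : ∀ᵐ ω ∂P, Continuous fun t : ℝ≥0 => x t ω
  intervalIntegrable_drift : ∀ᵐ ω ∂P, ∀ t : ℝ≥0,
    IntervalIntegrable (fun s : ℝ => b (x s.toNNReal ω)) volume 0 t
  equation : ∃ Y : ℝ≥0 → Ω → ℝ, IsItoIntegral F P W (fun s ω => σ (x s ω)) Y ∧
    ∀ᵐ ω ∂P, ∀ t : ℝ≥0,
      x t ω = x₀ + (∫ s in (0 : ℝ)..t, b (x s.toNNReal ω)) + Y t ω

/-!
The coefficients being linear, the solution is geometric Brownian motion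
`exp ((μ - α² / 2) t + α W t)`. Its power with exponent `γ = 1 - 2 μ / α² > 0` is the exponential
martingale `exp (β W t - β² t / 2)` with `β = γ α`, so Doob's maximal inequality bounds the
probability that the solution ever exceeds `R` by `R ^ (-γ)`.

The bulk of the work is the identification of the solution, for which Itô's formula is avoided.
A process is compared with its *Euler sums*
`∑ X (t i) (μ (t (i + 1) - t i) + α (W (t (i + 1)) - W (t i)))` over uniform partitions of `[0, t]`.

* For a solution, the Euler sums converge in probability to `x t - 1`
  (`IsSDESolution.tendstoInMeasure_eulerSum`). An Itô integral is here any limit in probability of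
  integrals of simple processes, so it has to be shown that Riemann sums compute it. This follows
  from an estimate of the integral of a simple process in probability by its quadratic variation
  (`SimpleProcess.measure_le_abs_integral_sub_le`), proved by stopping and the discrete isometry.
* For geometric Brownian motion, they converge to its increment
  (`tendstoInMeasure_eulerSum_gbm`), since by the formulas for Gaussian exponential moments the
  local errors have conditional mean and variance `o(t / n)`.
* The difference `D` of the two is thus the limit of its own Euler sums. A Grönwall argument for
  the second moments of `D`, cut off when it exceeds a level `K`, shows that `D` vanishes
  (`ae_eq_zero_of_tendstoInMeasure_eulerSum`). Working at rational times avoids all questions of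
  joint measurability.
-/

/-! ### Convergence in measure -/

lemma tendstoInMeasure_add {Ω : Type*} {mΩ : MeasurableSpace Ω} {P : Measure Ω}
    {f g : ℕ → Ω → ℝ} {f' g' : Ω → ℝ} (hf : TendstoInMeasure P f atTop f')
    (hg : TendstoInMeasure P g atTop g') :
    TendstoInMeasure P (fun n ω => f n ω + g n ω) atTop (fun ω => f' ω + g' ω) := by
  rw [tendstoInMeasure_iff_norm] at *
  intro ε hε
  have h := (hf (ε / 2) (half_pos hε)).add (hg (ε / 2) (half_pos hε))
  rw [add_zero] at h
  refine tendsto_of_tendsto_of_tendsto_of_le_of_le tendsto_const_nhds h (fun _ => zero_le)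
    fun n => ?_
  refine (measure_mono ?_).trans (measure_union_le _ _)
  intro ω hω
  simp only [Set.mem_ofPred_eq, Set.mem_union, Real.norm_eq_abs] at *
  by_contra! hc
  have := abs_add_le (f n ω - f' ω) (g n ω - g' ω)
  have e : f n ω + g n ω - (f' ω + g' ω) = f n ω - f' ω + (g n ω - g' ω) := by ring
  rw [e] at hω
  linarith [hc.1, hc.2]

lemma tendstoInMeasure_neg {Ω : Type*} {mΩ : MeasurableSpace Ω} {P : Measure Ω}
    {f : ℕ → Ω → ℝ} {f' : Ω → ℝ} (hf : TendstoInMeasure P f atTop f') :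
    TendstoInMeasure P (fun n ω => - f n ω) atTop (fun ω => - f' ω) := by
  rw [tendstoInMeasure_iff_norm] at *
  intro ε hε
  refine (hf ε hε).congr fun n => ?_
  congr 1
  ext ω
  simp only [Set.mem_ofPred_eq]
  rw [← norm_neg, show -(f n ω - f' ω) = -f n ω - -f' ω by ring]

/-- Chebyshev's inequality for the second moment about the origin. -/
lemma measure_le_abs_le_integral_sq {Ω : Type*} {mΩ : MeasurableSpace Ω} {P : Measure Ω}
    [IsFiniteMeasure P] {f : Ω → ℝ} (hf : MemLp f 2 P) {ε : ℝ} (hε : 0 < ε) :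
    P {ω | ε ≤ |f ω|} ≤ ENNReal.ofReal ((∫ ω, f ω ^ 2 ∂P) / ε ^ 2) := by
  have h := mul_meas_ge_le_integral_of_nonneg (μ := P) (f := fun ω => f ω ^ 2)
    (ae_of_all _ fun ω => sq_nonneg _) hf.integrable_sq (ε ^ 2)
  have e : {ω | ε ≤ |f ω|} = {ω | ε ^ 2 ≤ f ω ^ 2} := by
    ext ω
    simp only [Set.mem_ofPred_eq]
    rw [← sq_abs (f ω)]
    exact (pow_le_pow_iff_left₀ hε.le (abs_nonneg _) two_ne_zero).symm
  rw [e, ← ENNReal.ofReal_toReal (measure_ne_top P _)]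
  refine ENNReal.ofReal_le_ofReal ?_
  rw [le_div_iff₀ (by positivity), mul_comm]
  exact h

lemma tendstoInMeasure_zero_of_integral_sq {Ω : Type*} {mΩ : MeasurableSpace Ω} {P : Measure Ω}
    [IsFiniteMeasure P] {f : ℕ → Ω → ℝ} (hf : ∀ n, MemLp (f n) 2 P)
    (h : Tendsto (fun n => ∫ ω, f n ω ^ 2 ∂P) atTop (𝓝 0)) :
    TendstoInMeasure P f atTop (fun _ => 0) := by
  rw [tendstoInMeasure_iff_norm]
  intro ε hε
  have h' := ENNReal.tendsto_ofReal (h.div_const (ε ^ 2))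
  rw [zero_div, ENNReal.ofReal_zero] at h'
  refine tendsto_of_tendsto_of_tendsto_of_le_of_le tendsto_const_nhds h' (fun _ => zero_le)
    fun n => ?_
  simpa using measure_le_abs_le_integral_sq (hf n) hε

/-! ### Discrete stochastic integrals -/

lemma memLp_two_mul_of_indep {Ω : Type*} {m₁ mΩ : MeasurableSpace Ω} {P : Measure Ω}
    {X Y : Ω → ℝ}
    (hX : Measurable[m₁] X) (hX2 : MemLp X 2 P) (hY : MemLp Y 2 P)
    (hind : Indep (MeasurableSpace.comap Y inferInstance) m₁ P) :
    MemLp (fun ω => X ω * Y ω) 2 P ∧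
      ∫ ω, (X ω * Y ω) ^ 2 ∂P = (∫ ω, X ω ^ 2 ∂P) * ∫ ω, Y ω ^ 2 ∂P := by
  have hi : IndepFun X Y P := by
    rw [IndepFun_iff_Indep]
    exact (indep_of_indep_of_le_right hind (hX.comap_le)).symm
  have hi2 : IndepFun (fun ω => X ω ^ 2) (fun ω => Y ω ^ 2) P :=
    hi.comp (measurable_id.pow_const 2) (measurable_id.pow_const 2)
  have e : (fun ω => (X ω * Y ω) ^ 2) = fun ω => X ω ^ 2 * Y ω ^ 2 := by
    ext ω; ring
  constructor
  · rw [memLp_two_iff_integrable_sq (show AEStronglyMeasurable (fun ω => X ω * Y ω) P from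
      hX2.1.mul hY.1), e]
    exact hi2.integrable_mul hX2.integrable_sq hY.integrable_sq
  · rw [e]
    exact hi2.integral_fun_mul_eq_mul_integral hX2.integrable_sq.1 hY.integrable_sq.1

lemma integral_mul_eq_zero_of_indep {Ω : Type*} {m₁ mΩ : MeasurableSpace Ω} {P : Measure Ω}
    (hm : m₁ ≤ mΩ) {X Y : Ω → ℝ}
    (hX : Measurable[m₁] X) (hY : AEStronglyMeasurable Y P)
    (hind : Indep (MeasurableSpace.comap Y inferInstance) m₁ P) (h0 : ∫ ω, Y ω ∂P = 0) :
    ∫ ω, X ω * Y ω ∂P = 0 := by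
  have hi : IndepFun X Y P := by
    rw [IndepFun_iff_Indep]
    exact (indep_of_indep_of_le_right hind (hX.comap_le)).symm
  rw [hi.integral_fun_mul_eq_mul_integral (hX.mono hm le_rfl).aestronglyMeasurable hY, h0,
    mul_zero]

/-- A sequence of square integrable, centred innovations relative to a discrete filtration: `Δ j`
is known at time `j + 1`, independent of the past up to time `j`, and has variance `v j`. -/
structure IsInnovation {Ω : Type*} {mΩ : MeasurableSpace Ω} (G : Filtration ℕ mΩ)
    (P : Measure Ω) (Δ : ℕ → Ω → ℝ) (v : ℕ → ℝ) : Prop where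
  meas : ∀ j, Measurable[G (j + 1)] (Δ j)
  memLp : ∀ j, MemLp (Δ j) 2 P
  indep : ∀ j, Indep (MeasurableSpace.comap (Δ j) inferInstance) (G j) P
  mean : ∀ j, ∫ ω, Δ j ω ∂P = 0
  var : ∀ j, ∫ ω, Δ j ω ^ 2 ∂P = v j

/-- The discrete Itô isometry. -/
lemma IsInnovation.isometry {Ω : Type*} {mΩ : MeasurableSpace Ω} {G : Filtration ℕ mΩ}
    {P : Measure Ω} {Δ : ℕ → Ω → ℝ} {v : ℕ → ℝ} (h : IsInnovation G P Δ v)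
    {ζ : ℕ → Ω → ℝ} (hζ : ∀ j, Measurable[G j] (ζ j)) (hζ2 : ∀ j, MemLp (ζ j) 2 P) (m : ℕ) :
    MemLp (fun ω => ∑ j ∈ Finset.range m, ζ j ω * Δ j ω) 2 P ∧
      ∫ ω, (∑ j ∈ Finset.range m, ζ j ω * Δ j ω) ^ 2 ∂P =
        ∑ j ∈ Finset.range m, (∫ ω, ζ j ω ^ 2 ∂P) * v j := by
  have hmeas : ∀ m, Measurable[G m] (fun ω => ∑ j ∈ Finset.range m, ζ j ω * Δ j ω) := by
    intro m
    refine Finset.measurable_fun_sum _ fun j hj => ?_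
    have hj := Finset.mem_range.1 hj
    exact ((hζ j).mono (G.mono hj.le) le_rfl).mul ((h.meas j).mono (G.mono hj) le_rfl)
  induction m with
  | zero => simp
  | succ m ih =>
    obtain ⟨ih1, ih2⟩ := ih
    obtain ⟨h1, h2⟩ := memLp_two_mul_of_indep (hζ m) (hζ2 m) (h.memLp m) (h.indep m)
    simp only [Finset.sum_range_succ]
    refine ⟨ih1.add h1, ?_⟩
    have hmul : Measurable[G m]
        (fun ω => (∑ j ∈ Finset.range m, ζ j ω * Δ j ω) * ζ m ω) := (hmeas m).mul (hζ m)
    have hc : ∫ ω, ((∑ j ∈ Finset.range m, ζ j ω * Δ j ω) * ζ m ω) * Δ m ω ∂P = 0 :=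
      integral_mul_eq_zero_of_indep (G.le m) hmul (h.memLp m).1 (h.indep m)
        (h.mean m)
    have hci : Integrable
        (fun ω => 2 * (((∑ j ∈ Finset.range m, ζ j ω * Δ j ω) * ζ m ω) * Δ m ω)) P := by
      have := (ih1.integrable_mul h1).const_mul 2
      refine this.congr (ae_of_all _ fun ω => ?_)
      simp only [Pi.mul_apply]; ring
    have e : (fun ω => (∑ j ∈ Finset.range m, ζ j ω * Δ j ω + ζ m ω * Δ m ω) ^ 2) =
        fun ω => ((∑ j ∈ Finset.range m, ζ j ω * Δ j ω) ^ 2 +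
          2 * (((∑ j ∈ Finset.range m, ζ j ω * Δ j ω) * ζ m ω) * Δ m ω)) +
          (ζ m ω * Δ m ω) ^ 2 := by
      ext ω; ring
    have hadd : Integrable (fun ω => (∑ j ∈ Finset.range m, ζ j ω * Δ j ω) ^ 2 +
        2 * (((∑ j ∈ Finset.range m, ζ j ω * Δ j ω) * ζ m ω) * Δ m ω)) P :=
      ih1.integrable_sq.add hci
    rw [e, integral_add hadd h1.integrable_sq, integral_add ih1.integrable_sq hci,
      integral_const_mul, hc, ih2, h2, h.var m]
    ring

/-- A discrete stochastic integral is small in probability as soon as its quadratic variation is: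
stopping the sum before the quadratic variation exceeds `δ` leaves a variable of second moment at
most `δ`. -/
lemma IsInnovation.measure_le_abs_sum_le {Ω : Type*} {mΩ : MeasurableSpace Ω}
    {G : Filtration ℕ mΩ} {P : Measure Ω} [IsProbabilityMeasure P] {Δ : ℕ → Ω → ℝ} {v : ℕ → ℝ}
    (h : IsInnovation G P Δ v) (hv : ∀ j, 0 ≤ v j) {ζ : ℕ → Ω → ℝ}
    (hζ : ∀ j, Measurable[G j] (ζ j)) (hb : ∀ j, ∃ C : ℝ, ∀ ω, |ζ j ω| ≤ C) (m : ℕ)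
    {ε δ : ℝ} (hε : 0 < ε) (hδ : 0 < δ) :
    P {ω | ε ≤ |∑ j ∈ Finset.range m, ζ j ω * Δ j ω|} ≤
      P {ω | δ < ∑ j ∈ Finset.range m, ζ j ω ^ 2 * v j} + ENNReal.ofReal (δ / ε ^ 2) := by
  let S : ℕ → Ω → ℝ := fun j ω => ∑ i ∈ Finset.range j, ζ i ω ^ 2 * v i
  let A : ℕ → Set Ω := fun j => {ω | S (j + 1) ω ≤ δ}
  have hSmono : ∀ ω, Monotone fun j => S j ω := fun ω => monotone_nat_of_le_succ fun j => by
    simp only [S, Finset.sum_range_succ]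
    have := mul_nonneg (sq_nonneg (ζ j ω)) (hv j)
    linarith
  have hA : ∀ j, MeasurableSet[G j] (A j) := by
    intro j
    suffices hS : Measurable[G j] (S (j + 1)) from hS measurableSet_Iic
    refine Finset.measurable_fun_sum _ fun i hi => ?_
    have hi := Nat.lt_succ_iff.1 (Finset.mem_range.1 hi)
    exact ((((hζ i).mono (G.mono hi) le_rfl)).pow_const 2).mul_const _
  let ζ' : ℕ → Ω → ℝ := fun j => (A j).indicator (ζ j)
  have hζ' : ∀ j, Measurable[G j] (ζ' j) := fun j => (hζ j).indicator (hA j)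
  have hζ'2 : ∀ j, MemLp (ζ' j) 2 P := by
    intro j
    obtain ⟨C, hC⟩ := hb j
    refine MemLp.of_bound ((hζ' j).mono (G.le j) le_rfl).aestronglyMeasurable C
      (ae_of_all _ fun ω => ?_)
    exact (norm_indicator_le_norm_self _ _).trans (hC ω)
  obtain ⟨h1, h2⟩ := h.isometry hζ' hζ'2 m
  have hpt : ∀ ω n, ∑ j ∈ Finset.range n, ζ' j ω ^ 2 * v j ≤ S n ω ∧
      ∑ j ∈ Finset.range n, ζ' j ω ^ 2 * v j ≤ δ := by
    intro ω n
    induction n with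
    | zero => simp [S, hδ.le]
    | succ n ih =>
      have hs : S (n + 1) ω = S n ω + ζ n ω ^ 2 * v n := by
        simp only [S, Finset.sum_range_succ]
      rw [Finset.sum_range_succ]
      by_cases hω : ω ∈ A n
      · have e : ζ' n ω = ζ n ω := Set.indicator_of_mem hω _
        have : S (n + 1) ω ≤ δ := hω
        rw [e]
        constructor <;> linarith [ih.1]
      · have e : ζ' n ω = 0 := Set.indicator_of_notMem hω _
        have := mul_nonneg (sq_nonneg (ζ n ω)) (hv n)
        rw [e]
        constructor <;> linarith [ih.1, ih.2]
  have h3 : ∫ ω, (∑ j ∈ Finset.range m, ζ' j ω * Δ j ω) ^ 2 ∂P ≤ δ := by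
    rw [h2]
    simp_rw [← integral_mul_const]
    rw [← integral_finsetSum _ fun j _ => (hζ'2 j).integrable_sq.mul_const _]
    calc _ ≤ ∫ _, δ ∂P := by
          refine integral_mono (integrable_finsetSum _ fun j _ =>
            (hζ'2 j).integrable_sq.mul_const _) (integrable_const _) fun ω => (hpt ω m).2
      _ = δ := by simp
  have hsub : {ω | ε ≤ |∑ j ∈ Finset.range m, ζ j ω * Δ j ω|} ⊆
      {ω | δ < ∑ j ∈ Finset.range m, ζ j ω ^ 2 * v j} ∪
        {ω | ε ≤ |∑ j ∈ Finset.range m, ζ' j ω * Δ j ω|} := by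
    intro ω hω
    by_cases hc : δ < ∑ j ∈ Finset.range m, ζ j ω ^ 2 * v j
    · exact Or.inl hc
    · right
      have : ∑ j ∈ Finset.range m, ζ' j ω * Δ j ω = ∑ j ∈ Finset.range m, ζ j ω * Δ j ω := by
        refine Finset.sum_congr rfl fun j hj => ?_
        have hj := Finset.mem_range.1 hj
        have : ω ∈ A j := ((hSmono ω) (Nat.succ_le_of_lt hj)).trans (not_lt.1 hc)
        simp only [ζ', Set.indicator_of_mem this]
      simpa only [Set.mem_ofPred_eq, this] using hω
  refine (measure_mono hsub).trans ((measure_union_le _ _).trans ?_)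
  gcongr
  refine (measure_le_abs_le_integral_sq h1 hε).trans (ENNReal.ofReal_le_ofReal ?_)
  gcongr

/-! ### Brownian increments along a partition -/

/-- The discrete filtration obtained by observing `F` along the nondecreasing times `u`. -/
def sampledFiltration {Ω : Type*} {mΩ : MeasurableSpace Ω} (F : Filtration ℝ≥0 mΩ)
    {u : ℕ → ℝ≥0} (hu : Monotone u) : Filtration ℕ mΩ where
  seq j := F (u j)
  mono' := fun _ _ h => F.mono (hu h)
  le' j := F.le (u j)

lemma IsBrownianMotionRel.hasLaw_sub {Ω : Type*} {mΩ : MeasurableSpace Ω}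
    {F : Filtration ℝ≥0 mΩ} {P : Measure Ω} {W : ℝ≥0 → Ω → ℝ} (hW : IsBrownianMotionRel F P W)
    {s t : ℝ≥0} (hst : s ≤ t) :
    HasLaw (fun ω => W t ω - W s ω) (gaussianReal 0 (t - s)) P := by
  have h := hW.isBrownian.toIsPreBrownianReal.hasLaw_sub t s
  have e : nndist t.1 s.1 = t - s := by
    ext
    rw [coe_nndist, NNReal.coe_sub hst]
    exact (Real.dist_eq _ _).trans (abs_of_nonneg (sub_nonneg.2 hst))
  rw [e] at h
  exact h

lemma IsBrownianMotionRel.measurable {Ω : Type*} {mΩ : MeasurableSpace Ω}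
    {F : Filtration ℝ≥0 mΩ} {P : Measure Ω} {W : ℝ≥0 → Ω → ℝ} (hW : IsBrownianMotionRel F P W)
    {s t : ℝ≥0} (hst : s ≤ t) : Measurable[F t] (W s) :=
  (hW.adapted s).mono (F.mono hst) le_rfl

/-- Brownian increments along a partition stopped at time `t`. -/
lemma IsBrownianMotionRel.isInnovation {Ω : Type*} {mΩ : MeasurableSpace Ω}
    {F : Filtration ℝ≥0 mΩ} {P : Measure Ω} [IsProbabilityMeasure P] {W : ℝ≥0 → Ω → ℝ}
    (hW : IsBrownianMotionRel F P W) {u : ℕ → ℝ≥0} (hu : Monotone u) (t : ℝ≥0) :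
    IsInnovation (sampledFiltration F hu) P
      (fun j ω => W (min (u (j + 1)) t) ω - W (min (u j) t) ω)
      (fun j => ((min (u (j + 1)) t : ℝ≥0) : ℝ) - (min (u j) t : ℝ≥0)) := by
  have hle : ∀ j, min (u j) t ≤ min (u (j + 1)) t := fun j =>
    min_le_min_right _ (hu (Nat.le_succ j))
  have hmem : ∀ j, MemLp (fun ω => W (min (u (j + 1)) t) ω - W (min (u j) t) ω) 2 P := fun j =>
    (hW.hasLaw_sub (hle j)).hasGaussianLaw.memLp_two
  have hmean : ∀ j, ∫ ω, W (min (u (j + 1)) t) ω - W (min (u j) t) ω ∂P = 0 := fun j => by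
    rw [(hW.hasLaw_sub (hle j)).integral_eq, integral_id_gaussianReal]
  refine ⟨fun j => ?_, hmem, fun j => ?_, hmean, fun j => ?_⟩
  · exact Measurable.sub (hW.measurable (min_le_left _ _))
      (hW.measurable ((min_le_left _ _).trans (hu (Nat.le_succ j))))
  · rcases le_total (u j) t with h | h
    · have := hW.indep_increment _ _ (hle j)
      rwa [min_eq_left h] at this ⊢
    · -- past `t` the stopped increment vanishes
      have e : (fun ω => W (min (u (j + 1)) t) ω - W (min (u j) t) ω) = fun _ => 0 := by
        ext ω
        rw [min_eq_right h, min_eq_right (h.trans (hu (Nat.le_succ j))), sub_self]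
      rw [e, MeasurableSpace.comap_const]
      exact indep_bot_left _
  · have hv := (hW.hasLaw_sub (hle j)).variance_eq
    rw [variance_id_gaussianReal, variance_of_integral_eq_zero (hmem j).1.aemeasurable (hmean j)]
      at hv
    rw [hv, NNReal.coe_sub (hle j)]

/-! ### Simple processes on a common partition -/

/-- Every finite set of times is visited by a nondecreasing sequence in finitely many steps. -/
lemma exists_monotone_visiting (U : Finset ℝ≥0) :
    ∃ (u : ℕ → ℝ≥0) (m : ℕ), Monotone u ∧ ∀ x ∈ U, ∃ a ≤ m, u a = x := by
  rcases U.eq_empty_or_nonempty with rfl | hU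
  · exact ⟨fun _ => 0, 0, monotone_const, by simp⟩
  · obtain ⟨k, hk⟩ := Nat.exists_eq_succ_of_ne_zero hU.card_ne_zero
    refine ⟨fun j => U.orderEmbOfFin hk ⟨min j k, by omega⟩, k, fun i j h => ?_, fun x hx => ?_⟩
    · apply (U.orderEmbOfFin hk).monotone
      simp only [Fin.mk_le_mk]
      omega
    · have : x ∈ Set.range (U.orderEmbOfFin hk) := by
        rw [Finset.range_orderEmbOfFin]; exact hx
      obtain ⟨⟨a, ha⟩, rfl⟩ := this
      refine ⟨a, by omega, ?_⟩
      have : min a k = a := by omega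
      simp only [this]

/-- The value of a simple process on the `j`-th interval of a partition `u` which contains the
times of the process. Written in this form it is visibly `F (u j)`-measurable. -/
noncomputable def SimpleProcess.coeff {Ω : Type*} {mΩ : MeasurableSpace Ω}
    {F : Filtration ℝ≥0 mΩ} (S : SimpleProcess F) (u : ℕ → ℝ≥0) (j : ℕ) (ω : Ω) : ℝ :=
  ∑ i ∈ Finset.range S.n, if S.t i ≤ u j ∧ u (j + 1) ≤ S.t (i + 1) then S.ξ i ω else 0

lemma SimpleProcess.measurable_coeff {Ω : Type*} {mΩ : MeasurableSpace Ω}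
    {F : Filtration ℝ≥0 mΩ} (S : SimpleProcess F) (u : ℕ → ℝ≥0) (j : ℕ) :
    Measurable[F (u j)] (S.coeff u j) := by
  refine Finset.measurable_fun_sum _ fun i _ => ?_
  by_cases h : S.t i ≤ u j ∧ u (j + 1) ≤ S.t (i + 1)
  · simp only [h, and_self, if_true]
    exact (S.meas i).mono (F.mono h.1) le_rfl
  · simp only [h, if_false]
    exact measurable_const

lemma SimpleProcess.coeff_bdd {Ω : Type*} {mΩ : MeasurableSpace Ω}
    {F : Filtration ℝ≥0 mΩ} (S : SimpleProcess F) (u : ℕ → ℝ≥0) (j : ℕ) :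
    ∃ C : ℝ, ∀ ω, |S.coeff u j ω| ≤ C := by
  choose C hC using S.bdd
  refine ⟨∑ i ∈ Finset.range S.n, C i, fun ω => (Finset.abs_sum_le_sum_abs _ _).trans ?_⟩
  refine Finset.sum_le_sum fun i _ => ?_
  split_ifs
  · exact hC i ω
  · rw [abs_zero]; exact (abs_nonneg _).trans (hC i ω)

lemma SimpleProcess.val_eq_coeff {Ω : Type*} {mΩ : MeasurableSpace Ω}
    {F : Filtration ℝ≥0 mΩ} (S : SimpleProcess F) {u : ℕ → ℝ≥0} (hu : Monotone u)
    (hS : ∀ i ≤ S.n, ∃ a, u a = S.t i) {j : ℕ} {s : ℝ≥0}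
    (hs : s ∈ Set.Ioc (u j) (u (j + 1))) (ω : Ω) : S.val s ω = S.coeff u j ω := by
  have key : ∀ i ≤ S.n, (S.t i < s ↔ S.t i ≤ u j) ∧ (s ≤ S.t i ↔ u (j + 1) ≤ S.t i) := by
    intro i hi
    obtain ⟨a, ha⟩ := hS i hi
    rw [← ha]
    rcases Nat.lt_or_ge j a with h | h
    · have h1 : u (j + 1) ≤ u a := hu h
      have h2 := hs.2.trans h1
      exact ⟨⟨fun h' => absurd h' (not_lt.2 h2), fun h' => absurd (hs.1.trans_le h2) (not_lt.2 h')⟩,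
        ⟨fun _ => h1, fun _ => h2⟩⟩
    · have h1 : u a ≤ u j := hu h
      have h2 := h1.trans_lt hs.1
      exact ⟨⟨fun _ => h1, fun _ => h2⟩,
        ⟨fun h' => absurd h' (not_le.2 h2), fun h' => absurd (h2.trans_le hs.2) (not_lt.2 h')⟩⟩
  refine Finset.sum_congr rfl fun i hi => ?_
  have hi := Finset.mem_range.1 hi
  simp only [Set.indicator_apply, Set.mem_Ioc, (key i hi.le).1, (key (i + 1) hi).2]

lemma SimpleProcess.integral_eq_coeff {Ω : Type*} {mΩ : MeasurableSpace Ω}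
    {F : Filtration ℝ≥0 mΩ} (S : SimpleProcess F) {u : ℕ → ℝ≥0} (hu : Monotone u) {m : ℕ}
    (hS : ∀ i ≤ S.n, ∃ a ≤ m, u a = S.t i) (W : ℝ≥0 → Ω → ℝ) (t : ℝ≥0) (ω : Ω) :
    S.integral W t ω = ∑ j ∈ Finset.range m,
      S.coeff u j ω * (W (min (u (j + 1)) t) ω - W (min (u j) t) ω) := by
  simp only [SimpleProcess.integral, SimpleProcess.coeff, Finset.sum_mul]
  rw [Finset.sum_comm]
  refine Finset.sum_congr rfl fun i hi => ?_
  have hi := Finset.mem_range.1 hi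
  obtain ⟨a, b, hab, hb, ha', hb'⟩ : ∃ a b, a ≤ b ∧ b ≤ m ∧ u a = S.t i ∧ u b = S.t (i + 1) := by
    obtain ⟨a, ha, ha'⟩ := hS i hi.le
    obtain ⟨b, hb, hb'⟩ := hS (i + 1) hi
    rcases le_total a b with h | h
    · exact ⟨a, b, h, hb, ha', hb'⟩
    · refine ⟨a, a, le_rfl, ha, ha', ?_⟩
      refine le_antisymm ?_ ?_
      · rw [ha']; exact S.mono (Nat.le_succ i)
      · rw [← hb']; exact hu h
  rw [← ha', ← hb', ← Finset.sum_Ico_sub (fun j => W (min (u j) t) ω) hab, Finset.mul_sum]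
  have hsub : Finset.Ico a b ⊆ Finset.range m := fun j hj => by
    simp only [Finset.mem_Ico, Finset.mem_range] at *; omega
  have hin : ∀ j ∈ Finset.Ico a b, u a ≤ u j ∧ u (j + 1) ≤ u b := fun j hj => by
    have := Finset.mem_Ico.1 hj
    exact ⟨hu this.1, hu this.2⟩
  rw [← Finset.sum_subset hsub]
  · exact Finset.sum_congr rfl fun j hj => by rw [if_pos (hin j hj)]
  · -- outside `[a, b)` a partition interval between `u a` and `u b` is empty
    intro j _ hj
    by_cases hc : u a ≤ u j ∧ u (j + 1) ≤ u b
    · have : u j = u (j + 1) := by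
        refine le_antisymm (hu (Nat.le_succ j)) ?_
        rw [Finset.mem_Ico, not_and_or, not_le, not_lt] at hj
        rcases hj with h | h
        · exact (hu (Nat.succ_le_of_lt h)).trans hc.1
        · exact hc.2.trans (hu h)
      rw [← this, sub_self, mul_zero]
    · rw [if_neg hc, zero_mul]

/-- The integral of a function constant on the intervals of a partition, restricted to `[0, t]`. -/
lemma ofReal_sum_le_lintegral {f : ℝ≥0 → ℝ} {c : ℕ → ℝ} {u : ℕ → ℝ≥0} (hu : Monotone u)
    (hf : ∀ j, ∀ s ∈ Set.Ioc (u j) (u (j + 1)), f s = c j) (t : ℝ≥0) (m : ℕ) :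
    ENNReal.ofReal (∑ j ∈ Finset.range m,
      c j ^ 2 * (((min (u (j + 1)) t : ℝ≥0) : ℝ) - (min (u j) t : ℝ≥0))) ≤
      ∫⁻ s in Set.Icc (0 : ℝ) t, ENNReal.ofReal (f s.toNNReal ^ 2) := by
  have hle : ∀ j, ((min (u j) t : ℝ≥0) : ℝ) ≤ (min (u (j + 1)) t : ℝ≥0) := fun j =>
    NNReal.coe_le_coe.2 (min_le_min_right _ (hu (Nat.le_succ j)))
  have hmono : Monotone fun j => ((min (u j) t : ℝ≥0) : ℝ) := monotone_nat_of_le_succ hle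
  have hdisj : ((Finset.range m : Finset ℕ) : Set ℕ).PairwiseDisjoint
      fun j => Set.Ioc ((min (u j) t : ℝ≥0) : ℝ) (min (u (j + 1)) t : ℝ≥0) :=
    fun i _ j _ hij => hmono.pairwise_disjoint_on_Ioc_succ hij
  have key : ENNReal.ofReal (∑ j ∈ Finset.range m,
      c j ^ 2 * (((min (u (j + 1)) t : ℝ≥0) : ℝ) - (min (u j) t : ℝ≥0))) =
      ∫⁻ s in ⋃ j ∈ Finset.range m,
        Set.Ioc ((min (u j) t : ℝ≥0) : ℝ) (min (u (j + 1)) t : ℝ≥0),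
          ENNReal.ofReal (f s.toNNReal ^ 2) := by
    rw [lintegral_biUnion_finset hdisj (fun _ _ => measurableSet_Ioc), ENNReal.ofReal_sum_of_nonneg]
    · refine Finset.sum_congr rfl fun j _ => ?_
      have : ∫⁻ s in Set.Ioc ((min (u j) t : ℝ≥0) : ℝ) (min (u (j + 1)) t : ℝ≥0),
          ENNReal.ofReal (f s.toNNReal ^ 2) =
          ∫⁻ _ in Set.Ioc ((min (u j) t : ℝ≥0) : ℝ) (min (u (j + 1)) t : ℝ≥0),
            ENNReal.ofReal (c j ^ 2) := by
        refine setLIntegral_congr_fun measurableSet_Ioc fun s hs => ?_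
        have hs0 : 0 ≤ s := (NNReal.coe_nonneg _).trans hs.1.le
        lift s to ℝ≥0 using hs0
        have h1 := NNReal.coe_lt_coe.1 hs.1
        have h2 := le_min_iff.1 (NNReal.coe_le_coe.1 hs.2)
        simp only [Real.toNNReal_coe]
        rw [hf j s ⟨?_, h2.1⟩]
        rcases min_lt_iff.1 h1 with h | h
        · exact h
        · exact absurd h (not_lt.2 h2.2)
      rw [this, setLIntegral_const, Real.volume_Ioc, ENNReal.ofReal_mul (sq_nonneg _)]
    · exact fun j _ => mul_nonneg (sq_nonneg _) (sub_nonneg.2 (hle j))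
  rw [key]
  refine lintegral_mono_set (Set.iUnion₂_subset fun j _ s hs => ⟨?_, ?_⟩)
  · exact (NNReal.coe_nonneg _).trans hs.1.le
  · exact hs.2.trans (NNReal.coe_le_coe.2 (min_le_right _ _))

/-- The Itô integrals of two simple processes are close in probability when the processes are close
in `L²[0, t]` in probability. -/
lemma SimpleProcess.measure_le_abs_integral_sub_le {Ω : Type*} {mΩ : MeasurableSpace Ω}
    {F : Filtration ℝ≥0 mΩ} {P : Measure Ω} [IsProbabilityMeasure P] {W : ℝ≥0 → Ω → ℝ}
    (hW : IsBrownianMotionRel F P W) (S Z : SimpleProcess F) (t : ℝ≥0) {ε δ : ℝ} (hε : 0 < ε)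
    (hδ : 0 < δ) :
    P {ω | ε ≤ |S.integral W t ω - Z.integral W t ω|} ≤
      P {ω | ENNReal.ofReal δ ≤ ∫⁻ s in Set.Icc (0 : ℝ) t,
        ENNReal.ofReal ((S.val s.toNNReal ω - Z.val s.toNNReal ω) ^ 2)} +
      ENNReal.ofReal (δ / ε ^ 2) := by
  obtain ⟨u, m, hu, hum⟩ := exists_monotone_visiting
    ((Finset.range (S.n + 1)).image S.t ∪ (Finset.range (Z.n + 1)).image Z.t)
  have hS : ∀ i ≤ S.n, ∃ a ≤ m, u a = S.t i := fun i hi => hum _ <|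
    Finset.mem_union_left _ (Finset.mem_image_of_mem _ (Finset.mem_range.2 (by omega)))
  have hZ : ∀ i ≤ Z.n, ∃ a ≤ m, u a = Z.t i := fun i hi => hum _ <|
    Finset.mem_union_right _ (Finset.mem_image_of_mem _ (Finset.mem_range.2 (by omega)))
  have hin := hW.isInnovation hu t
  have hmain := hin.measure_le_abs_sum_le (ζ := fun j ω => S.coeff u j ω - Z.coeff u j ω)
    (fun j => sub_nonneg.2 (NNReal.coe_le_coe.2 (min_le_min_right _ (hu (Nat.le_succ j)))))
    (fun j => (S.measurable_coeff u j).sub (Z.measurable_coeff u j))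
    (fun j => by
      obtain ⟨C, hC⟩ := S.coeff_bdd u j
      obtain ⟨C', hC'⟩ := Z.coeff_bdd u j
      exact ⟨C + C', fun ω => (abs_sub _ _).trans (add_le_add (hC ω) (hC' ω))⟩) m hε hδ
  refine le_trans (le_of_eq ?_) (hmain.trans ?_)
  · congr 1
    ext ω
    simp only [Set.mem_ofPred_eq, S.integral_eq_coeff hu hS, Z.integral_eq_coeff hu hZ,
      ← Finset.sum_sub_distrib, sub_mul]
  · gcongr
    rename_i ω
    intro hω
    refine (ENNReal.ofReal_le_ofReal (le_of_lt hω)).trans ?_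
    refine ofReal_sum_le_lintegral (f := fun s => S.val s ω - Z.val s ω) hu (fun j s hs => ?_) t m
    rw [S.val_eq_coeff hu (fun i hi => (hS i hi).imp fun _ h => h.2) hs,
      Z.val_eq_coeff hu (fun i hi => (hZ i hi).imp fun _ h => h.2) hs]

/-! ### Uniform partitions -/

lemma exists_nnratCast_btwn {a b : ℝ≥0} (h : a < b) :
    ∃ q : ℚ≥0, a < (q : ℝ≥0) ∧ (q : ℝ≥0) < b := by
  obtain ⟨q, h1, h2⟩ := exists_rat_btwn (NNReal.coe_lt_coe.2 h)
  have hq : (0 : ℚ) ≤ q := by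
    have : (0 : ℝ) < q := lt_of_le_of_lt a.coe_nonneg h1
    exact_mod_cast this.le
  lift q to ℚ≥0 using hq
  refine ⟨q, ?_, ?_⟩
  · rw [← NNReal.coe_lt_coe, show (((q : ℚ≥0) : ℝ≥0) : ℝ) = (q : ℝ) from rfl]; simpa using h1
  · rw [← NNReal.coe_lt_coe, show (((q : ℚ≥0) : ℝ≥0) : ℝ) = (q : ℝ) from rfl]; simpa using h2

lemma denseRange_nnratCast : DenseRange ((↑) : ℚ≥0 → ℝ≥0) := by
  refine dense_of_exists_between fun a b hab => ?_
  obtain ⟨q, h1, h2⟩ := exists_nnratCast_btwn hab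
  exact ⟨q, ⟨q, rfl⟩, h1, h2⟩

/-- The `i`-th point of the partition of `[0, t]` into `n` intervals of equal length. -/
noncomputable def grid (t : ℝ≥0) (n i : ℕ) : ℝ≥0 := t * i / n

lemma grid_mono (t : ℝ≥0) (n : ℕ) : Monotone (grid t n) := fun i j h => by
  unfold grid; gcongr

@[simp] lemma grid_zero (t : ℝ≥0) (n : ℕ) : grid t n 0 = 0 := by simp [grid]

lemma grid_self (t : ℝ≥0) {n : ℕ} (hn : n ≠ 0) : grid t n n = t := by
  have : (n : ℝ≥0) ≠ 0 := Nat.cast_ne_zero.2 hn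
  simp [grid, this]

lemma coe_grid (t : ℝ≥0) (n i : ℕ) : (grid t n i : ℝ) = i * (t / n) := by
  simp only [grid, NNReal.coe_div, NNReal.coe_mul, NNReal.coe_natCast]; ring

lemma grid_succ_sub (t : ℝ≥0) (n i : ℕ) : (grid t n (i + 1) : ℝ) - grid t n i = t / n := by
  simp only [coe_grid]; push_cast; ring

lemma grid_le {t : ℝ≥0} {n i : ℕ} (hi : i ≤ n) : grid t n i ≤ t := by
  rcases Nat.eq_zero_or_pos n with rfl | hn
  · simp [grid]
  · calc grid t n i ≤ grid t n n := grid_mono t n hi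
      _ = t := grid_self t hn.ne'

lemma exists_mem_grid_Ioc {t s : ℝ≥0} {n : ℕ} (hn : n ≠ 0) (hs : s ∈ Set.Ioc 0 t) :
    ∃ j < n, s ∈ Set.Ioc (grid t n j) (grid t n (j + 1)) := by
  have h := (grid_mono t n).biUnion_Ico_Ioc_map_succ 0 n
  rw [grid_zero, grid_self t hn] at h
  rw [← h] at hs
  simp only [Set.mem_iUnion, Set.mem_Ico, exists_prop] at hs
  obtain ⟨j, hj, hs⟩ := hs
  exact ⟨j, hj.2, hs⟩

lemma eventually_grid_close {y : ℝ≥0 → ℝ} (hy : Continuous y) (t : ℝ≥0) {ε : ℝ} (hε : 0 < ε) :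
    ∀ᶠ n : ℕ in atTop, ∀ i < n, ∀ s ∈ Set.Icc (grid t n i) (grid t n (i + 1)),
      |y s - y (grid t n i)| ≤ ε := by
  have hu := isCompact_Icc.uniformContinuousOn_of_continuous (hy.continuousOn (s := Set.Icc 0 t))
  obtain ⟨δ, hδ, h⟩ := Metric.uniformContinuousOn_iff.1 hu ε hε
  have ht : Tendsto (fun n : ℕ => (t : ℝ) / n) atTop (𝓝 0) := tendsto_const_div_atTop_nhds_zero_nat _
  filter_upwards [ht.eventually (gt_mem_nhds hδ)] with n hn i hi s hs
  refine (h s ⟨zero_le, hs.2.trans (grid_le hi)⟩ _ ⟨zero_le, grid_le hi.le⟩ ?_).le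
  have h1 := NNReal.coe_le_coe.2 hs.1
  have h2 := NNReal.coe_le_coe.2 hs.2
  have h3 := grid_succ_sub t n i
  rw [NNReal.dist_eq, abs_of_nonneg (by linarith)]
  linarith

/-- Riemann sums over uniform partitions. -/
lemma tendsto_riemannSum {y : ℝ≥0 → ℝ} (hy : Continuous y) (t : ℝ≥0) :
    Tendsto (fun n : ℕ => ∑ i ∈ Finset.range n, y (grid t n i) * ((t : ℝ) / n)) atTop
      (𝓝 (∫ s in (0 : ℝ)..t, y s.toNNReal)) := by
  rw [Metric.tendsto_nhds]
  intro ε hε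
  have hε' : 0 < ε / (t + 1) := by positivity
  have hc : Continuous fun s : ℝ => y s.toNNReal := hy.comp continuous_real_toNNReal
  filter_upwards [eventually_grid_close hy t hε', eventually_ne_atTop 0] with n hn hn0
  have h0 : ∫ s in (0 : ℝ)..t, y s.toNNReal =
      ∑ i ∈ Finset.range n, ∫ s in (grid t n i : ℝ)..(grid t n (i + 1)), y s.toNNReal := by
    rw [intervalIntegral.sum_integral_adjacent_intervals (a := fun i => (grid t n i : ℝ))
      fun k _ => hc.intervalIntegrable _ _, grid_self t hn0, grid_zero, NNReal.coe_zero]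
  have h1 : ∀ i, y (grid t n i) * ((t : ℝ) / n) =
      ∫ _ in (grid t n i : ℝ)..(grid t n (i + 1)), y (grid t n i) := fun i => by
    rw [intervalIntegral.integral_const, grid_succ_sub, smul_eq_mul, mul_comm]
  rw [h0, dist_comm, Real.dist_eq, ← Finset.sum_sub_distrib]
  calc _ ≤ ∑ i ∈ Finset.range n, ε / (t + 1) * ((t : ℝ) / n) := by
        refine (Finset.abs_sum_le_sum_abs _ _).trans (Finset.sum_le_sum fun i hi => ?_)
        have hi := Finset.mem_range.1 hi
        rw [h1, ← intervalIntegral.integral_sub (hc.intervalIntegrable _ _)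
          intervalIntegrable_const]
        have hle : (grid t n i : ℝ) ≤ grid t n (i + 1) := grid_mono t n (Nat.le_succ i)
        have := intervalIntegral.norm_integral_le_of_norm_le_const
          (f := fun s : ℝ => y s.toNNReal - y (grid t n i)) (a := grid t n i)
          (b := grid t n (i + 1)) (C := ε / (t + 1)) fun s hs => ?_
        · rwa [grid_succ_sub, abs_of_nonneg (a := (t : ℝ) / n) (by positivity)] at this
        · rw [Set.uIoc_of_le hle] at hs
          have hs0 : 0 ≤ s := (NNReal.coe_nonneg _).trans hs.1.le
          lift s to ℝ≥0 using hs0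
          rw [Real.toNNReal_coe]
          exact hn i hi s ⟨(NNReal.coe_lt_coe.1 hs.1).le, NNReal.coe_le_coe.1 hs.2⟩
    _ = ε * (t / (t + 1)) := by
        have : (n : ℝ) ≠ 0 := Nat.cast_ne_zero.2 hn0
        rw [Finset.sum_const, Finset.card_range, nsmul_eq_mul]
        field_simp
    _ < ε := by
        refine mul_lt_of_lt_one_right hε ?_
        rw [div_lt_one (by positivity)]
        linarith

/-! ### Itô integrals of continuous integrands are limits of Riemann sums -/

/-- The simple process which freezes `H`, truncated at level `n`, on the intervals of the uniform
partition of `[0, t]` into `n` intervals. -/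
noncomputable def frozenProcess {Ω : Type*} {mΩ : MeasurableSpace Ω} {F : Filtration ℝ≥0 mΩ}
    {H : ℝ≥0 → Ω → ℝ} (hH : Adapted F H) (t : ℝ≥0) (n : ℕ) : SimpleProcess F where
  n := n
  t := grid t n
  mono := grid_mono t n
  ξ i ω := max (-(n : ℝ)) (min n (H (grid t n i) ω))
  meas i := measurable_const.max (measurable_const.min (hH _))
  bdd i := ⟨n, fun ω => abs_le.2 ⟨le_max_left _ _, max_le (by
    have : (0 : ℝ) ≤ n := n.cast_nonneg
    linarith) (min_le_left _ _)⟩⟩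

lemma max_neg_min_eq_self {a b : ℝ} (h : |a| ≤ b) : max (-b) (min b a) = a := by
  rw [abs_le] at h
  rw [min_eq_right h.2, max_eq_right h.1]

lemma frozenProcess_val {Ω : Type*} {mΩ : MeasurableSpace Ω} {F : Filtration ℝ≥0 mΩ}
    {H : ℝ≥0 → Ω → ℝ} (hH : Adapted F H) (t : ℝ≥0) {n j : ℕ} (hj : j < n) {s : ℝ≥0}
    (hs : s ∈ Set.Ioc (grid t n j) (grid t n (j + 1))) (ω : Ω) :
    (frozenProcess hH t n).val s ω = max (-(n : ℝ)) (min n (H (grid t n j) ω)) := by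
  simp only [SimpleProcess.val, frozenProcess]
  rw [Finset.sum_eq_single j]
  · rw [Set.indicator_of_mem hs]
  · intro i _ hij
    refine Set.indicator_of_notMem (fun h => ?_) _
    exact Set.disjoint_left.1 ((grid_mono t n).pairwise_disjoint_on_Ioc_succ hij) h hs
  · intro h
    exact absurd (Finset.mem_range.2 hj) h

lemma eventually_abs_grid_le {y : ℝ≥0 → ℝ} (hy : Continuous y) (t : ℝ≥0) :
    ∀ᶠ n : ℕ in atTop, ∀ i ≤ n, |y (grid t n i)| ≤ n := by
  obtain ⟨C, hC⟩ := (isCompact_Icc (a := (0 : ℝ≥0)) (b := t)).exists_bound_of_continuousOn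
    hy.continuousOn
  obtain ⟨N, hN⟩ := exists_nat_ge C
  filter_upwards [eventually_ge_atTop N] with n hn i hi
  exact (hC _ ⟨zero_le, grid_le hi⟩).trans (hN.trans (Nat.cast_le.2 hn))

/-- The frozen processes converge to `H` uniformly on `[0, t]`, and this is controlled by events
which are measurable because they only involve rational times. -/
lemma exists_measurable_frozenProcess_close {Ω : Type*} {mΩ : MeasurableSpace Ω}
    {F : Filtration ℝ≥0 mΩ} {P : Measure Ω} [IsProbabilityMeasure P] {H : ℝ≥0 → Ω → ℝ}
    (hH : Adapted F H) (hc : ∀ᵐ ω ∂P, Continuous fun s => H s ω) (t : ℝ≥0) {η : ℝ} (hη : 0 < η) :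
    ∃ B : ℕ → Set Ω, Tendsto (fun n => P (B n)) atTop (𝓝 0) ∧
      ∀ᵐ ω ∂P, ∀ n ≠ 0, ω ∉ B n → ∀ s ∈ Set.Ioc 0 t,
        |(frozenProcess hH t n).val s ω - H s ω| ≤ η := by
  let B : ℕ → Set Ω := fun n => ⋃ i ∈ Finset.range n, ⋃ q : ℚ≥0, {ω |
    (q : ℝ≥0) ∈ Set.Icc (grid t n i) (grid t n (i + 1)) ∧
      η < |max (-(n : ℝ)) (min n (H (grid t n i) ω)) - H q ω|}
  have hmeas : ∀ s, Measurable (H s) := fun s => (hH s).mono (F.le s) le_rfl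
  have hB : ∀ n, MeasurableSet (B n) := by
    intro n
    refine Finset.measurableSet_biUnion _ fun i _ => MeasurableSet.iUnion fun q => ?_
    have hm : Measurable fun ω => |max (-(n : ℝ)) (min n (H (grid t n i) ω)) - H q ω| :=
      ((measurable_const.max (measurable_const.min (hmeas _))).sub (hmeas _)).norm
    exact MeasurableSet.inter (MeasurableSet.const _) (hm measurableSet_Ioi)
  refine ⟨B, ?_, ?_⟩
  · rw [← measure_empty (μ := P)]
    refine tendsto_measure_of_ae_tendsto_indicator_of_isFiniteMeasure atTop MeasurableSet.empty hB ?_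
    filter_upwards [hc] with ω hω
    filter_upwards [eventually_grid_close hω t hη, eventually_abs_grid_le hω t] with n h1 h2
    simp only [Set.mem_empty_iff_false, iff_false, B, Set.mem_iUnion, Finset.mem_range,
      Set.mem_ofPred_eq, not_exists, not_and, not_lt]
    intro i hi q hq
    rw [max_neg_min_eq_self (h2 i hi.le), abs_sub_comm]
    exact h1 i hi q hq
  · filter_upwards [hc] with ω hω n hn hB s hs
    obtain ⟨j, hj, hsj⟩ := exists_mem_grid_Ioc hn hs
    rw [frozenProcess_val hH t hj hsj]
    simp only [B, Set.mem_iUnion, Finset.mem_range, Set.mem_ofPred_eq, not_exists, not_and,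
      not_lt] at hB
    have hclosed : IsClosed {s | |max (-(n : ℝ)) (min n (H (grid t n j) ω)) - H s ω| ≤ η} :=
      isClosed_le (continuous_const.sub hω).abs continuous_const
    have hlt : grid t n j < grid t n (j + 1) := hsj.1.trans_le hsj.2
    by_contra hcon
    -- near a point where the bound fails there is a rational time where it fails
    have hs' : s ∈ closure (Set.Ioo (grid t n j) (grid t n (j + 1))) := by
      rw [closure_Ioo hlt.ne]; exact Set.Ioc_subset_Icc_self hsj
    have hne := mem_closure_iff.1 hs' _ hclosed.isOpen_compl hcon
    have hopen := hclosed.isOpen_compl.inter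
      (isOpen_Ioo (a := grid t n j) (b := grid t n (j + 1)))
    obtain ⟨_, ⟨h1, h2⟩, q, rfl⟩ := denseRange_nnratCast.inter_open_nonempty _ hopen hne
    exact h1 (hB j hj q (Set.Ioo_subset_Icc_self h2))

lemma SimpleProcess.measurable_val {Ω : Type*} {mΩ : MeasurableSpace Ω}
    {F : Filtration ℝ≥0 mΩ} (S : SimpleProcess F) (ω : Ω) : Measurable fun s => S.val s ω :=
  Finset.measurable_fun_sum _ fun _ _ => measurable_const.indicator measurableSet_Ioc

lemma lintegral_sq_sub_le {f g h : ℝ → ℝ} (hf : Measurable f) (hg : Measurable g) (ν : Measure ℝ) :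
    ∫⁻ s, ENNReal.ofReal ((f s - h s) ^ 2) ∂ν ≤
      2 * ∫⁻ s, ENNReal.ofReal ((f s - g s) ^ 2) ∂ν +
      2 * ∫⁻ s, ENNReal.ofReal ((h s - g s) ^ 2) ∂ν := by
  have hm : Measurable fun s => 2 * ENNReal.ofReal ((f s - g s) ^ 2) :=
    ((hf.sub hg).pow_const 2).ennreal_ofReal.const_mul 2
  rw [← lintegral_const_mul' _ _ (by simp), ← lintegral_const_mul' _ _ (by simp),
    ← lintegral_add_left hm]
  refine lintegral_mono fun s => ?_
  rw [show (2 : ℝ≥0∞) = ENNReal.ofReal 2 by simp, ← ENNReal.ofReal_mul (by norm_num),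
    ← ENNReal.ofReal_mul (by norm_num), ← ENNReal.ofReal_add (by positivity) (by positivity)]
  refine ENNReal.ofReal_le_ofReal ?_
  nlinarith [sq_nonneg (f s - g s + (h s - g s))]

/-- The Itô integral of a continuous adapted process is the limit in probability of the Riemann sums
over uniform partitions with the integrand evaluated at the left endpoints. -/
lemma IsItoIntegral.tendstoInMeasure_riemannSum {Ω : Type*} {mΩ : MeasurableSpace Ω}
    {F : Filtration ℝ≥0 mΩ} {P : Measure Ω} [IsProbabilityMeasure P] {W H Y : ℝ≥0 → Ω → ℝ}
    (hW : IsBrownianMotionRel F P W) (hY : IsItoIntegral F P W H Y)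
    (hc : ∀ᵐ ω ∂P, Continuous fun s => H s ω) (t : ℝ≥0) :
    TendstoInMeasure P (fun (n : ℕ) ω => ∑ i ∈ Finset.range n,
      H (grid t n i) ω * (W (grid t n (i + 1)) ω - W (grid t n i) ω)) atTop (Y t) := by
  obtain ⟨S, hS1, hS2⟩ := hY.approx
  let Z : ℕ → SimpleProcess F := frozenProcess hY.adapted t
  have hHm : ∀ s, Measurable (H s) := fun s => (hY.adapted s).mono (F.le s) le_rfl
  have hWm : ∀ s, Measurable (W s) := fun s => (hW.adapted s).mono (F.le s) le_rfl
  -- the two approximations are close in `L²[0, t]`, in probability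
  have hclose : ∀ δ : ℝ, 0 < δ → Tendsto (fun k => P {ω | ENNReal.ofReal δ ≤
      ∫⁻ s in Set.Icc (0 : ℝ) t,
        ENNReal.ofReal (((S k).val s.toNNReal ω - (Z k).val s.toNNReal ω) ^ 2)})
      atTop (𝓝 0) := by
    intro δ hδ
    obtain ⟨η, hη, hηδ⟩ : ∃ η : ℝ, 0 < η ∧ η ^ 2 * t < δ / 4 := by
      refine ⟨min 1 (δ / (8 * (t + 1))), by positivity, ?_⟩
      have h1 : min 1 (δ / (8 * (t + 1))) ≤ 1 := min_le_left _ _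
      have h2 : min 1 (δ / (8 * (t + 1))) ≤ δ / (8 * (t + 1)) := min_le_right _ _
      have h3 : 0 < min 1 (δ / (8 * (t + 1))) := by positivity
      have ht := t.coe_nonneg
      calc min 1 (δ / (8 * (t + 1))) ^ 2 * (t : ℝ)
          ≤ δ / (8 * (t + 1)) * (t + 1) := by
            rw [sq]
            refine mul_le_mul ?_ (by linarith) ht (by positivity)
            calc _ ≤ 1 * min 1 (δ / (8 * (t + 1))) := by gcongr
              _ ≤ _ := by linarith
        _ = δ / 8 := by field_simp
        _ < δ / 4 := by linarith
    obtain ⟨B, hB0, hB⟩ := exists_measurable_frozenProcess_close hY.adapted hc t hη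
    have hlim := (hS1 t (ENNReal.ofReal (δ / 4)) (by simpa using by linarith)).add hB0
    rw [add_zero] at hlim
    refine tendsto_of_tendsto_of_tendsto_of_le_of_le' tendsto_const_nhds hlim
      (Eventually.of_forall fun _ => zero_le) ?_
    filter_upwards [eventually_ne_atTop 0] with n hn
    refine (measure_mono_ae ?_).trans (measure_union_le _ _)
    filter_upwards [hB, hc] with ω hω hcω hmem
    by_cases hBn : ω ∈ B n
    · exact Or.inr hBn
    left
    by_contra hlt
    have hlt : ∫⁻ s in Set.Icc (0 : ℝ) t,
        ENNReal.ofReal (((S n).val s.toNNReal ω - H s.toNNReal ω) ^ 2) < ENNReal.ofReal (δ / 4) :=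
      not_le.1 hlt
    have hZ : ∫⁻ s in Set.Icc (0 : ℝ) t,
        ENNReal.ofReal (((Z n).val s.toNNReal ω - H s.toNNReal ω) ^ 2) <
          ENNReal.ofReal (δ / 4) := by
      rw [← setLIntegral_congr (Ioc_ae_eq_Icc (μ := volume) (a := (0 : ℝ)) (b := t))]
      calc _ ≤ ∫⁻ _ in Set.Ioc (0 : ℝ) t, ENNReal.ofReal (η ^ 2) := by
            refine setLIntegral_mono measurable_const fun s hs => ENNReal.ofReal_le_ofReal ?_
            rw [← sq_abs]
            gcongr
            refine hω n hn hBn s.toNNReal ⟨Real.toNNReal_pos.2 hs.1, ?_⟩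
            exact Real.toNNReal_le_iff_le_coe.2 hs.2
        _ = ENNReal.ofReal (η ^ 2 * t) := by
            rw [setLIntegral_const, Real.volume_Ioc, sub_zero, ENNReal.ofReal_mul (sq_nonneg _)]
        _ < _ := (ENNReal.ofReal_lt_ofReal_iff (by linarith)).2 hηδ
    have hle := lintegral_sq_sub_le (f := fun s : ℝ => (S n).val s.toNNReal ω)
      (g := fun s : ℝ => H s.toNNReal ω) (h := fun s : ℝ => (Z n).val s.toNNReal ω)
      (((S n).measurable_val ω).comp measurable_real_toNNReal)
      (hcω.measurable.comp measurable_real_toNNReal) (volume.restrict (Set.Icc (0 : ℝ) t))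
    have hfin := (show ENNReal.ofReal δ ≤ _ from hmem).trans hle
    refine absurd hfin (not_le.2 ?_)
    calc _ < 2 * ENNReal.ofReal (δ / 4) + 2 * ENNReal.ofReal (δ / 4) := by
          refine ENNReal.add_lt_add ?_ ?_
          · exact (ENNReal.mul_lt_mul_iff_right (by simp) (by simp)).2 hlt
          · exact (ENNReal.mul_lt_mul_iff_right (by simp) (by simp)).2 hZ
      _ = ENNReal.ofReal δ := by
          rw [show (2 : ℝ≥0∞) = ENNReal.ofReal 2 by simp, ← ENNReal.ofReal_mul (by norm_num),
            ← ENNReal.ofReal_add (by positivity) (by positivity)]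
          congr 1; ring
  have hdiff : TendstoInMeasure P (fun k ω => (S k).integral W t ω - (Z k).integral W t ω) atTop
      (fun _ => 0) := by
    rw [tendstoInMeasure_iff_norm]
    intro ε hε
    simp only [sub_zero, Real.norm_eq_abs]
    rw [ENNReal.tendsto_atTop_zero]
    intro κ hκ
    obtain ⟨δ, hδ, hδκ⟩ : ∃ δ : ℝ, 0 < δ ∧ ENNReal.ofReal (δ / ε ^ 2) ≤ κ / 2 := by
      by_cases hκt : κ = ⊤
      · exact ⟨1, one_pos, by simp [hκt, ENNReal.top_div]⟩
      · refine ⟨κ.toReal / 2 * ε ^ 2, ?_, ?_⟩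
        · have := ENNReal.toReal_pos hκ.ne' hκt
          positivity
        · rw [mul_div_assoc, div_self (by positivity), mul_one,
            ENNReal.ofReal_div_of_pos two_pos, ENNReal.ofReal_toReal hκt]
          simp
    obtain ⟨N, hN⟩ := ENNReal.tendsto_atTop_zero.1 (hclose δ hδ) (κ / 2)
      (ENNReal.half_pos hκ.ne')
    refine ⟨N, fun n hn => ?_⟩
    calc _ ≤ _ := SimpleProcess.measure_le_abs_integral_sub_le hW (S n) (Z n) t hε hδ
      _ ≤ κ / 2 + κ / 2 := add_le_add (hN n hn) hδκ
      _ = κ := ENNReal.add_halves κ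
  -- the truncation in the frozen processes is eventually inactive along each path
  have htrunc : TendstoInMeasure P (fun (n : ℕ) ω => ∑ i ∈ Finset.range n,
      H (grid t n i) ω * (W (grid t n (i + 1)) ω - W (grid t n i) ω) - (Z n).integral W t ω)
      atTop (fun _ => 0) := by
    refine tendstoInMeasure_of_tendsto_ae (fun n => Measurable.aestronglyMeasurable ?_) ?_
    · refine Measurable.sub ?_ ?_
      · exact Finset.measurable_fun_sum _ fun i _ => (hHm _).mul ((hWm _).sub (hWm _))
      · exact Finset.measurable_fun_sum _ fun i _ =>
          (((Z n).meas i).mono (F.le _) le_rfl).mul ((hWm _).sub (hWm _))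
    · filter_upwards [hc] with ω hω
      refine tendsto_const_nhds.congr' ?_
      filter_upwards [eventually_abs_grid_le hω t] with n hn
      rw [eq_comm, sub_eq_zero]
      refine Finset.sum_congr rfl fun i hi => ?_
      have hi : i < n := Finset.mem_range.1 hi
      simp only [Z, frozenProcess]
      rw [max_neg_min_eq_self (hn i hi.le), min_eq_left (grid_le (Nat.succ_le_of_lt hi)),
        min_eq_left (grid_le hi.le)]
  have := tendstoInMeasure_add (tendstoInMeasure_add htrunc (tendstoInMeasure_neg hdiff)) (hS2 t)
  refine TendstoInMeasure.congr (fun n => ae_of_all _ fun ω => ?_) (ae_of_all _ fun ω => ?_) this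
  · ring
  · ring

/-- The increment over `[0, t]` of the Euler scheme, with `n` steps of equal length and coefficients
frozen along the process `X`, for the equation `dX = μ X dt + α X dW`. -/
noncomputable def eulerSum {Ω : Type*} (W : ℝ≥0 → Ω → ℝ) (μ α : ℝ) (X : ℝ≥0 → Ω → ℝ) (t : ℝ≥0)
    (n : ℕ) (ω : Ω) : ℝ :=
  ∑ i ∈ Finset.range n, X (grid t n i) ω *
    (μ * ((t : ℝ) / n) + α * (W (grid t n (i + 1)) ω - W (grid t n i) ω))

lemma tendstoInMeasure_integral_of_riemannSum {Ω : Type*} {mΩ : MeasurableSpace Ω} {P : Measure Ω}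
    [IsFiniteMeasure P] {X : ℝ≥0 → Ω → ℝ} (hX : ∀ s, Measurable (X s))
    (hc : ∀ᵐ ω ∂P, Continuous fun s => X s ω) (t : ℝ≥0) :
    TendstoInMeasure P (fun (n : ℕ) ω => ∑ i ∈ Finset.range n, X (grid t n i) ω * ((t : ℝ) / n))
      atTop (fun ω => ∫ s in (0 : ℝ)..t, X s.toNNReal ω) := by
  refine tendstoInMeasure_of_tendsto_ae (fun n => Measurable.aestronglyMeasurable ?_) ?_
  · exact Finset.measurable_fun_sum _ fun i _ => (hX _).mul_const _
  · filter_upwards [hc] with ω hω using tendsto_riemannSum hω t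

lemma IsSDESolution.tendstoInMeasure_eulerSum {Ω : Type*} {mΩ : MeasurableSpace Ω}
    {F : Filtration ℝ≥0 mΩ} {P : Measure Ω} [IsProbabilityMeasure P] {W x : ℝ≥0 → Ω → ℝ}
    (hW : IsBrownianMotionRel F P W) {μ α x₀ : ℝ}
    (hx : IsSDESolution F P W (fun y => μ * y) (fun y => α * y) x₀ x) (t : ℝ≥0) :
    TendstoInMeasure P (eulerSum W μ α x t) atTop (fun ω => x t ω - x₀) := by
  obtain ⟨Y, hY, heq⟩ := hx.equation
  have hmeas : ∀ s, Measurable (x s) := fun s => (hx.adapted s).mono (F.le s) le_rfl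
  have h1 := tendstoInMeasure_integral_of_riemannSum (P := P) (X := fun s ω => μ * x s ω)
    (fun s => (hmeas s).const_mul μ)
    (hx.continuous_path.mono fun ω h => continuous_const.mul h) t
  have h2 := hY.tendstoInMeasure_riemannSum hW
    (hx.continuous_path.mono fun ω h => continuous_const.mul h) t
  refine TendstoInMeasure.congr (fun n => ae_of_all _ fun ω => ?_) ?_ (tendstoInMeasure_add h1 h2)
  · simp only [eulerSum]
    rw [← Finset.sum_add_distrib]
    exact Finset.sum_congr rfl fun i _ => by ring
  · filter_upwards [heq] with ω hω
    rw [hω t]; ring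

/-! ### Exponential moments of centred Gaussian variables -/

lemma integrable_exp_mul_of_hasLaw {Ω : Type*} {mΩ : MeasurableSpace Ω} {P : Measure Ω}
    [IsProbabilityMeasure P] {X : Ω → ℝ} {h : ℝ≥0} (hX : HasLaw X (gaussianReal 0 h) P) (a : ℝ) :
    Integrable (fun ω => Real.exp (a * X ω)) P := by
  rw [← mgf_pos_iff, mgf_gaussianReal hX.map_eq]
  exact Real.exp_pos _

lemma integral_exp_mul_of_hasLaw {Ω : Type*} {mΩ : MeasurableSpace Ω} {P : Measure Ω}
    [IsProbabilityMeasure P] {X : Ω → ℝ} {h : ℝ≥0} (hX : HasLaw X (gaussianReal 0 h) P) (a : ℝ) :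
    ∫ ω, Real.exp (a * X ω) ∂P = Real.exp (h * a ^ 2 / 2) := by
  have := mgf_gaussianReal hX.map_eq a
  rwa [zero_mul, zero_add] at this

lemma integral_mul_exp_mul_of_hasLaw {Ω : Type*} {mΩ : MeasurableSpace Ω} {P : Measure Ω}
    [IsProbabilityMeasure P] {X : Ω → ℝ} {h : ℝ≥0} (hX : HasLaw X (gaussianReal 0 h) P) (a : ℝ) :
    ∫ ω, X ω * Real.exp (a * X ω) ∂P = h * a * Real.exp (h * a ^ 2 / 2) := by
  have hset : integrableExpSet X P = Set.univ :=
    Set.eq_univ_of_forall fun b => integrable_exp_mul_of_hasLaw hX b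
  have h1 := hasDerivAt_mgf (X := X) (μ := P) (t := a) (by rw [hset]; simp)
  have e : mgf X P = fun b => Real.exp (h * b ^ 2 / 2) :=
    funext fun b => integral_exp_mul_of_hasLaw hX b
  rw [e] at h1
  have h2 : HasDerivAt (fun b : ℝ => Real.exp (h * b ^ 2 / 2))
      (Real.exp (h * a ^ 2 / 2) * (h * (2 * a) / 2)) a := by
    have := (((hasDerivAt_pow 2 a).const_mul (h : ℝ)).div_const 2).exp
    simpa using this
  rw [h1.unique h2]
  ring

/-! ### Geometric Brownian motion -/

/-- Geometric Brownian motion with drift `μ` and volatility `α`, started from `1` when `W 0 = 0`. -/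
noncomputable def gbm {Ω : Type*} (W : ℝ≥0 → Ω → ℝ) (μ α : ℝ) (t : ℝ≥0) (ω : Ω) : ℝ :=
  Real.exp ((μ - α ^ 2 / 2) * t + α * W t ω)

/-- The factor by which geometric Brownian motion is multiplied over a time span of length `h` in
which the driving Brownian motion increases by `w`. -/
noncomputable def gbmFactor (μ α h w : ℝ) : ℝ := Real.exp ((μ - α ^ 2 / 2) * h + α * w)

lemma gbm_eq_mul {Ω : Type*} (W : ℝ≥0 → Ω → ℝ) (μ α : ℝ) (s t : ℝ≥0) (ω : Ω) :
    gbm W μ α t ω = gbm W μ α s ω * gbmFactor μ α (t - s) (W t ω - W s ω) := by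
  rw [gbm, gbm, gbmFactor, ← Real.exp_add]
  congr 1; ring

lemma measurable_gbmFactor (μ α h : ℝ) : Measurable (gbmFactor μ α h) := by
  unfold gbmFactor; fun_prop

lemma gbmFactor_sq (μ α h w : ℝ) :
    gbmFactor μ α h w ^ 2 = Real.exp ((2 * μ - α ^ 2) * h) * Real.exp ((2 * α) * w) := by
  rw [gbmFactor, ← Real.exp_nat_mul, ← Real.exp_add]
  congr 1; push_cast; ring

lemma gbmFactor_eq (μ α h w : ℝ) :
    gbmFactor μ α h w = Real.exp ((μ - α ^ 2 / 2) * h) * Real.exp (α * w) := by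
  rw [gbmFactor, Real.exp_add]

lemma memLp_gbmFactor {Ω : Type*} {mΩ : MeasurableSpace Ω} {P : Measure Ω}
    [IsProbabilityMeasure P] {X : Ω → ℝ} {h : ℝ≥0} (hX : HasLaw X (gaussianReal 0 h) P) (μ α : ℝ) :
    MemLp (fun ω => gbmFactor μ α h (X ω)) 2 P := by
  have hm : AEMeasurable (fun ω => gbmFactor μ α h (X ω)) P :=
    (measurable_gbmFactor μ α h).comp_aemeasurable hX.aemeasurable
  rw [memLp_two_iff_integrable_sq hm.aestronglyMeasurable]
  simp_rw [gbmFactor_sq]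
  exact (integrable_exp_mul_of_hasLaw hX _).const_mul _

lemma integral_gbmFactor {Ω : Type*} {mΩ : MeasurableSpace Ω} {P : Measure Ω}
    [IsProbabilityMeasure P] {X : Ω → ℝ} {h : ℝ≥0} (hX : HasLaw X (gaussianReal 0 h) P) (μ α : ℝ) :
    ∫ ω, gbmFactor μ α h (X ω) ∂P = Real.exp (μ * h) := by
  simp_rw [gbmFactor_eq]
  rw [integral_const_mul, integral_exp_mul_of_hasLaw hX, ← Real.exp_add]
  congr 1; ring

lemma integral_gbmFactor_sq {Ω : Type*} {mΩ : MeasurableSpace Ω} {P : Measure Ω}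
    [IsProbabilityMeasure P] {X : Ω → ℝ} {h : ℝ≥0} (hX : HasLaw X (gaussianReal 0 h) P) (μ α : ℝ) :
    ∫ ω, gbmFactor μ α h (X ω) ^ 2 ∂P = Real.exp ((2 * μ + α ^ 2) * h) := by
  simp_rw [gbmFactor_sq]
  rw [integral_const_mul, integral_exp_mul_of_hasLaw hX, ← Real.exp_add]
  congr 1; ring

lemma integral_mul_gbmFactor {Ω : Type*} {mΩ : MeasurableSpace Ω} {P : Measure Ω}
    [IsProbabilityMeasure P] {X : Ω → ℝ} {h : ℝ≥0} (hX : HasLaw X (gaussianReal 0 h) P) (μ α : ℝ) :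
    ∫ ω, X ω * gbmFactor μ α h (X ω) ∂P = h * α * Real.exp (μ * h) := by
  have e : (fun ω => X ω * gbmFactor μ α h (X ω)) = fun ω =>
      Real.exp ((μ - α ^ 2 / 2) * h) * (X ω * Real.exp (α * X ω)) := by
    ext ω; rw [gbmFactor_eq]; ring
  rw [e, integral_const_mul, integral_mul_exp_mul_of_hasLaw hX, mul_left_comm, ← Real.exp_add]
  congr 2; ring

/-- The variance of the second order remainder in the local expansion of geometric Brownian motion
over a time span of length `h`. It is `o(h)`. -/
noncomputable def gbmRemainderVar (μ α h : ℝ) : ℝ :=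
  Real.exp ((2 * μ + α ^ 2) * h) - Real.exp (2 * μ * h) - 2 * α ^ 2 * (h * Real.exp (μ * h)) +
    α ^ 2 * h

lemma integral_gbmRemainder_sq {Ω : Type*} {mΩ : MeasurableSpace Ω} {P : Measure Ω}
    [IsProbabilityMeasure P] {X : Ω → ℝ} {h : ℝ≥0} (hX : HasLaw X (gaussianReal 0 h) P) (μ α : ℝ) :
    MemLp (fun ω => gbmFactor μ α h (X ω) - Real.exp (μ * h) - α * X ω) 2 P ∧
    ∫ ω, gbmFactor μ α h (X ω) - Real.exp (μ * h) - α * X ω ∂P = 0 ∧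
    ∫ ω, (gbmFactor μ α h (X ω) - Real.exp (μ * h) - α * X ω) ^ 2 ∂P =
      gbmRemainderVar μ α h := by
  have hN := memLp_gbmFactor hX μ α
  have hX2 : MemLp X 2 P := hX.hasGaussianLaw.memLp_two
  have hX0 : ∫ ω, X ω ∂P = 0 := by rw [hX.integral_eq, integral_id_gaussianReal]
  have hXsq : ∫ ω, X ω ^ 2 ∂P = h := by
    have hv := hX.variance_eq
    rwa [variance_id_gaussianReal, variance_of_integral_eq_zero hX2.1.aemeasurable hX0] at hv
  have hNc : MemLp (fun ω => gbmFactor μ α h (X ω) - Real.exp (μ * h)) 2 P :=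
    hN.sub (memLp_const _)
  have hNi := hN.integrable one_le_two
  have hXi := hX2.integrable one_le_two
  have hNci := hNc.integrable one_le_two
  refine ⟨hNc.sub (hX2.const_mul α), ?_, ?_⟩
  · rw [integral_sub hNci (hXi.const_mul α), integral_sub hNi (integrable_const _),
      integral_const_mul, hX0, integral_gbmFactor hX]
    simp
  · have e : (fun ω => (gbmFactor μ α h (X ω) - Real.exp (μ * h) - α * X ω) ^ 2) = fun ω =>
        (((gbmFactor μ α h (X ω) ^ 2 - 2 * Real.exp (μ * h) * gbmFactor μ α h (X ω)) +
          (2 * Real.exp (μ * h) * α) * X ω) - (2 * α) * (X ω * gbmFactor μ α h (X ω))) +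
          α ^ 2 * X ω ^ 2 + Real.exp (μ * h) ^ 2 := by
      ext ω; ring
    have i1 := hN.integrable_sq
    have i2 := hNi.const_mul (2 * Real.exp (μ * h))
    have i3 := hXi.const_mul (2 * Real.exp (μ * h) * α)
    have i4 : Integrable (fun ω => (2 * α) * (X ω * gbmFactor μ α h (X ω))) P :=
      (hX2.integrable_mul hN).const_mul (2 * α)
    have i5 := hX2.integrable_sq.const_mul (α ^ 2)
    have j2 : Integrable (fun ω => gbmFactor μ α h (X ω) ^ 2 -
      2 * Real.exp (μ * h) * gbmFactor μ α h (X ω)) P := i1.sub i2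
    have j3 : Integrable (fun ω => gbmFactor μ α h (X ω) ^ 2 -
      2 * Real.exp (μ * h) * gbmFactor μ α h (X ω) + (2 * Real.exp (μ * h) * α) * X ω) P :=
      j2.add i3
    have j4 : Integrable (fun ω => gbmFactor μ α h (X ω) ^ 2 -
      2 * Real.exp (μ * h) * gbmFactor μ α h (X ω) + (2 * Real.exp (μ * h) * α) * X ω -
      (2 * α) * (X ω * gbmFactor μ α h (X ω))) P := j3.sub i4
    have j5 : Integrable (fun ω => gbmFactor μ α h (X ω) ^ 2 -
      2 * Real.exp (μ * h) * gbmFactor μ α h (X ω) + (2 * Real.exp (μ * h) * α) * X ω -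
      (2 * α) * (X ω * gbmFactor μ α h (X ω)) + α ^ 2 * X ω ^ 2) P := j4.add i5
    rw [e, integral_add j5 (integrable_const _), integral_add j4 i5, integral_sub j3 i4,
      integral_add j2 i3, integral_sub i1 i2, integral_const_mul, integral_const_mul,
      integral_const_mul, integral_const_mul, integral_gbmFactor_sq hX, integral_gbmFactor hX,
      integral_mul_gbmFactor hX, hX0, hXsq, integral_const, gbmRemainderVar]
    have e2 : Real.exp (2 * μ * h) = Real.exp (μ * h) ^ 2 := by
      rw [← Real.exp_nat_mul]; congr 1; push_cast; ring
    rw [e2]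
    simp
    ring

lemma IsBrownianMotionRel.hasLaw_eval {Ω : Type*} {mΩ : MeasurableSpace Ω}
    {F : Filtration ℝ≥0 mΩ} {P : Measure Ω} {W : ℝ≥0 → Ω → ℝ} (hW : IsBrownianMotionRel F P W)
    (t : ℝ≥0) : HasLaw (W t) (gaussianReal 0 t) P :=
  hW.isBrownian.toIsPreBrownianReal.hasLaw_eval t

lemma gbm_adapted {Ω : Type*} {mΩ : MeasurableSpace Ω} {F : Filtration ℝ≥0 mΩ}
    {W : ℝ≥0 → Ω → ℝ} (hW : Adapted F W) (μ α : ℝ) : Adapted F (gbm W μ α) := fun t =>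
  (((hW t).const_mul α).const_add _).exp

lemma memLp_gbm {Ω : Type*} {mΩ : MeasurableSpace Ω} {F : Filtration ℝ≥0 mΩ} {P : Measure Ω}
    [IsProbabilityMeasure P] {W : ℝ≥0 → Ω → ℝ} (hW : IsBrownianMotionRel F P W) (μ α : ℝ)
    (t : ℝ≥0) : MemLp (gbm W μ α t) 2 P :=
  memLp_gbmFactor (hW.hasLaw_eval t) μ α

lemma integral_gbm {Ω : Type*} {mΩ : MeasurableSpace Ω} {F : Filtration ℝ≥0 mΩ} {P : Measure Ω}
    [IsProbabilityMeasure P] {W : ℝ≥0 → Ω → ℝ} (hW : IsBrownianMotionRel F P W) (μ α : ℝ)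
    (t : ℝ≥0) : ∫ ω, gbm W μ α t ω ∂P = Real.exp (μ * t) :=
  integral_gbmFactor (hW.hasLaw_eval t) μ α

lemma integral_gbm_sq_le {Ω : Type*} {mΩ : MeasurableSpace Ω} {F : Filtration ℝ≥0 mΩ}
    {P : Measure Ω} [IsProbabilityMeasure P] {W : ℝ≥0 → Ω → ℝ} (hW : IsBrownianMotionRel F P W)
    (μ α : ℝ) {s t : ℝ≥0} (hst : s ≤ t) :
    ∫ ω, gbm W μ α s ω ^ 2 ∂P ≤ Real.exp (|2 * μ + α ^ 2| * t) := by
  refine (integral_gbmFactor_sq (hW.hasLaw_eval s) μ α).le.trans (Real.exp_le_exp.2 ?_)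
  exact mul_le_mul (le_abs_self _) (NNReal.coe_le_coe.2 hst) s.coe_nonneg (abs_nonneg _)

lemma tendsto_nat_mul_of_hasDerivAt_zero {f : ℝ → ℝ} (hf : HasDerivAt f 0 0) (h0 : f 0 = 0)
    (t : ℝ) : Tendsto (fun n : ℕ => (n : ℝ) * f (t / n)) atTop (𝓝 0) := by
  have ho := hasDerivAt_iff_isLittleO.1 hf
  have ht : Tendsto (fun n : ℕ => t / n) atTop (𝓝 0) := tendsto_const_div_atTop_nhds_zero_nat _
  rw [Metric.tendsto_nhds]
  intro ε hε
  have hc : 0 < ε / (|t| + 1) := by positivity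
  filter_upwards [ht.eventually (ho.def hc), eventually_ne_atTop 0] with n hn hn0
  have hn0' : (0 : ℝ) < n := Nat.cast_pos.2 (Nat.pos_of_ne_zero hn0)
  simp only [h0, sub_zero, smul_zero, Real.norm_eq_abs] at hn
  rw [dist_zero_right, Real.norm_eq_abs, abs_mul, Nat.abs_cast]
  calc (n : ℝ) * |f (t / n)| ≤ n * (ε / (|t| + 1) * |t / n|) := by gcongr
    _ = ε * (|t| / (|t| + 1)) := by
      rw [abs_div, Nat.abs_cast]; field_simp
    _ < ε := by
      refine mul_lt_of_lt_one_right hε ?_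
      rw [div_lt_one (by positivity)]
      linarith

lemma hasDerivAt_exp_const_mul_zero (a : ℝ) : HasDerivAt (fun h : ℝ => Real.exp (a * h)) a 0 := by
  simpa using ((hasDerivAt_id (0 : ℝ)).const_mul a).exp

lemma tendsto_nat_mul_gbmRemainderVar (μ α t : ℝ) :
    Tendsto (fun n : ℕ => (n : ℝ) * gbmRemainderVar μ α (t / n)) atTop (𝓝 0) := by
  refine tendsto_nat_mul_of_hasDerivAt_zero ?_ (by simp [gbmRemainderVar]) t
  have h := ((((hasDerivAt_exp_const_mul_zero (2 * μ + α ^ 2)).sub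
    (hasDerivAt_exp_const_mul_zero (2 * μ))).sub
    (((hasDerivAt_id (0 : ℝ)).mul (hasDerivAt_exp_const_mul_zero μ)).const_mul (2 * α ^ 2))).add
    ((hasDerivAt_id (0 : ℝ)).const_mul (α ^ 2)))
  refine h.congr_deriv ?_
  simp
  ring

lemma tendsto_nat_mul_exp_sub (μ t : ℝ) :
    Tendsto (fun n : ℕ => (n : ℝ) * (Real.exp (μ * (t / n)) - 1 - μ * (t / n))) atTop (𝓝 0) := by
  refine tendsto_nat_mul_of_hasDerivAt_zero (f := fun h => Real.exp (μ * h) - 1 - μ * h) ?_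
    (by simp) t
  have h := ((hasDerivAt_exp_const_mul_zero μ).sub_const 1).sub
    ((hasDerivAt_id (0 : ℝ)).const_mul μ)
  refine h.congr_deriv ?_
  simp

/-- The remainders in the local expansion of geometric Brownian motion along a uniform partition
are centred innovations. -/
lemma isInnovation_gbmRemainder {Ω : Type*} {mΩ : MeasurableSpace Ω} {F : Filtration ℝ≥0 mΩ}
    {P : Measure Ω} [IsProbabilityMeasure P] {W : ℝ≥0 → Ω → ℝ} (hW : IsBrownianMotionRel F P W)
    (μ α : ℝ) (t : ℝ≥0) (n : ℕ) :
    IsInnovation (sampledFiltration F (grid_mono t n)) P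
      (fun j ω => gbmFactor μ α ((t : ℝ) / n) (W (grid t n (j + 1)) ω - W (grid t n j) ω) -
        Real.exp (μ * ((t : ℝ) / n)) - α * (W (grid t n (j + 1)) ω - W (grid t n j) ω))
      (fun _ => gbmRemainderVar μ α ((t : ℝ) / n)) := by
  have hlaw : ∀ j, HasLaw (fun ω => W (grid t n (j + 1)) ω - W (grid t n j) ω)
      (gaussianReal 0 (t / n)) P := by
    intro j
    have hle := grid_mono t n (Nat.le_succ j)
    have h := hW.hasLaw_sub hle
    have e : grid t n (j + 1) - grid t n j = t / n := by
      ext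
      rw [NNReal.coe_sub hle, grid_succ_sub, NNReal.coe_div, NNReal.coe_natCast]
    rwa [e] at h
  have hmom := fun j => integral_gbmRemainder_sq (hlaw j) μ α
  simp only [NNReal.coe_div, NNReal.coe_natCast] at hmom
  have hg : Measurable fun w => gbmFactor μ α ((t : ℝ) / n) w - Real.exp (μ * ((t : ℝ) / n)) -
      α * w := by
    have := measurable_gbmFactor μ α ((t : ℝ) / n)
    fun_prop
  refine ⟨fun j => ?_, fun j => (hmom j).1, fun j => ?_, fun j => (hmom j).2.1,
    fun j => (hmom j).2.2⟩
  · exact hg.comp (Measurable.sub (hW.adapted _)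
      (hW.measurable (grid_mono t n (Nat.le_succ j))))
  · refine indep_of_indep_of_le_left (hW.indep_increment _ _ (grid_mono t n (Nat.le_succ j))) ?_
    exact (hg.comp (comap_measurable fun ω =>
      W (grid t n (j + 1)) ω - W (grid t n j) ω)).comap_le

lemma sq_sum_le_card_mul_sum_sq_range (f : ℕ → ℝ) (n : ℕ) :
    (∑ i ∈ Finset.range n, f i) ^ 2 ≤ n * ∑ i ∈ Finset.range n, f i ^ 2 := by
  simpa using sq_sum_le_card_mul_sum_sq (s := Finset.range n) (f := f)

/-- Geometric Brownian motion satisfies its equation in the sense of Euler sums: the remainders in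
its local expansion have conditional mean and variance `o(t / n)`. -/
lemma tendstoInMeasure_eulerSum_gbm {Ω : Type*} {mΩ : MeasurableSpace Ω}
    {F : Filtration ℝ≥0 mΩ} {P : Measure Ω} [IsProbabilityMeasure P] {W : ℝ≥0 → Ω → ℝ}
    (hW : IsBrownianMotionRel F P W) (μ α : ℝ) (t : ℝ≥0) :
    TendstoInMeasure P (eulerSum W μ α (gbm W μ α) t) atTop
      (fun ω => gbm W μ α t ω - gbm W μ α 0 ω) := by
  let E := gbm W μ α
  let C : ℝ := Real.exp (|2 * μ + α ^ 2| * t)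
  let η : ℕ → ℕ → Ω → ℝ := fun n j ω =>
    gbmFactor μ α ((t : ℝ) / n) (W (grid t n (j + 1)) ω - W (grid t n j) ω) -
        Real.exp (μ * ((t : ℝ) / n)) - α * (W (grid t n (j + 1)) ω - W (grid t n j) ω)
  have hE : ∀ s, MemLp (E s) 2 P := memLp_gbm hW μ α
  have h1 : TendstoInMeasure P
      (fun (n : ℕ) ω => ∑ i ∈ Finset.range n, E (grid t n i) ω * η n i ω) atTop (fun _ => 0) := by
    have hiso := fun n => (isInnovation_gbmRemainder hW μ α t n).isometry
      (ζ := fun j => E (grid t n j)) (fun j => gbm_adapted hW.adapted μ α _) (fun j => hE _) n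
    refine tendstoInMeasure_zero_of_integral_sq (fun n => (hiso n).1) ?_
    have hlim := (tendsto_nat_mul_gbmRemainderVar μ α t).const_mul C
    rw [mul_zero] at hlim
    refine tendsto_of_tendsto_of_tendsto_of_le_of_le tendsto_const_nhds hlim
      (fun n => integral_nonneg fun ω => sq_nonneg _) fun n => ?_
    refine (hiso n).2.le.trans ?_
    have hvar : 0 ≤ gbmRemainderVar μ α (t / n) := by
      rw [← (isInnovation_gbmRemainder hW μ α t n).var 0]
      exact integral_nonneg fun ω => sq_nonneg _
    calc _ ≤ ∑ j ∈ Finset.range n, C * gbmRemainderVar μ α (t / n) := by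
          refine Finset.sum_le_sum fun j hj => mul_le_mul_of_nonneg_right ?_ hvar
          exact integral_gbm_sq_le hW μ α (grid_le (Finset.mem_range.1 hj).le)
      _ = _ := by rw [Finset.sum_const, Finset.card_range, nsmul_eq_mul]; ring
  have h2 : TendstoInMeasure P (fun (n : ℕ) ω =>
      (Real.exp (μ * ((t : ℝ) / n)) - 1 - μ * ((t : ℝ) / n)) *
        ∑ i ∈ Finset.range n, E (grid t n i) ω) atTop (fun _ => 0) := by
    refine tendstoInMeasure_zero_of_integral_sq
      (fun n => (memLp_finsetSum _ fun i _ => hE _).const_mul _) ?_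
    have hlim := ((tendsto_nat_mul_exp_sub μ t).pow 2).const_mul C
    rw [zero_pow two_ne_zero, mul_zero] at hlim
    refine tendsto_of_tendsto_of_tendsto_of_le_of_le tendsto_const_nhds hlim
      (fun n => integral_nonneg fun ω => sq_nonneg _) fun n => ?_
    simp only [mul_pow, integral_const_mul]
    have hsum : ∫ ω, (∑ i ∈ Finset.range n, E (grid t n i) ω) ^ 2 ∂P ≤ n * (n * C) := by
      calc _ ≤ ∫ ω, (n : ℝ) * ∑ i ∈ Finset.range n, E (grid t n i) ω ^ 2 ∂P := by
            refine integral_mono (memLp_finsetSum _ fun i _ => hE _).integrable_sq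
              ((integrable_finsetSum _ fun i _ => (hE _).integrable_sq).const_mul _) fun ω => ?_
            exact sq_sum_le_card_mul_sum_sq_range _ n
        _ ≤ n * (n * C) := by
            rw [integral_const_mul, integral_finsetSum _ fun i _ => (hE _).integrable_sq]
            gcongr
            calc _ ≤ ∑ j ∈ Finset.range n, C := Finset.sum_le_sum fun j hj =>
                  integral_gbm_sq_le hW μ α (grid_le (Finset.mem_range.1 hj).le)
              _ = _ := by rw [Finset.sum_const, Finset.card_range, nsmul_eq_mul]
    calc _ ≤ (Real.exp (μ * ((t : ℝ) / n)) - 1 - μ * ((t : ℝ) / n)) ^ 2 * (n * (n * C)) := by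
          gcongr
      _ = _ := by ring
  have h3 := tendstoInMeasure_add (tendstoInMeasure_neg h1) (tendstoInMeasure_neg h2)
  have h4 : TendstoInMeasure P (fun _ ω => E t ω - E 0 ω) atTop (fun ω => E t ω - E 0 ω) :=
    tendstoInMeasure_of_tendsto_ae (fun _ => ((hE t).sub (hE 0)).1)
      (ae_of_all _ fun ω => tendsto_const_nhds)
  refine TendstoInMeasure.congr' ?_ (ae_of_all _ fun ω => ?_) (tendstoInMeasure_add h3 h4)
  · filter_upwards [eventually_ne_atTop 0] with n hn
    refine ae_of_all _ fun ω => ?_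
    have htel : E t ω - E 0 ω =
        ∑ i ∈ Finset.range n, (E (grid t n (i + 1)) ω - E (grid t n i) ω) := by
      rw [Finset.sum_range_sub (fun i => E (grid t n i) ω), grid_self t hn, grid_zero]
    simp only [htel, eulerSum]
    rw [Finset.mul_sum, ← Finset.sum_neg_distrib, ← Finset.sum_neg_distrib,
      ← Finset.sum_add_distrib, ← Finset.sum_add_distrib]
    refine Finset.sum_congr rfl fun i _ => ?_
    have hstep : E (grid t n (i + 1)) ω = E (grid t n i) ω *
        gbmFactor μ α ((t : ℝ) / n) (W (grid t n (i + 1)) ω - W (grid t n i) ω) := by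
      rw [← grid_succ_sub t n i]
      exact gbm_eq_mul W μ α (grid t n i) (grid t n (i + 1)) ω
    simp only [η, hstep]
    ring
  · simp [E]

/-! ### Uniqueness for the linear equation -/

/-- The event that `D` is bounded by `K` at all rational times up to `t`. -/
def boundedUpTo {Ω : Type*} (D : ℝ≥0 → Ω → ℝ) (K : ℝ) (t : ℝ≥0) : Set Ω :=
  {ω | ∀ q : ℚ≥0, (q : ℝ≥0) ≤ t → |D q ω| ≤ K}

/-- The process `D`, set to zero off the event that it is bounded by `K` up to the present. -/
noncomputable def cutoff {Ω : Type*} (D : ℝ≥0 → Ω → ℝ) (K : ℝ) (t : ℝ≥0) : Ω → ℝ :=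
  (boundedUpTo D K t).indicator (D t)

lemma measurableSet_boundedUpTo {Ω : Type*} {mΩ : MeasurableSpace Ω} {F : Filtration ℝ≥0 mΩ}
    {D : ℝ≥0 → Ω → ℝ} (hD : Adapted F D) (K : ℝ) (t : ℝ≥0) :
    MeasurableSet[F t] (boundedUpTo D K t) := by
  have e : boundedUpTo D K t =
      ⋂ q : ℚ≥0, ⋂ _ : (q : ℝ≥0) ≤ t, {ω | |D q ω| ≤ K} := by
    ext ω; simp [boundedUpTo]
  rw [e]
  refine MeasurableSet.iInter fun q => MeasurableSet.iInter fun hq => ?_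
  have hm : Measurable[F t] fun ω => |D q ω| :=
    measurable_norm.comp ((hD q).mono (F.mono hq) le_rfl)
  exact hm measurableSet_Iic

lemma measurable_cutoff {Ω : Type*} {mΩ : MeasurableSpace Ω} {F : Filtration ℝ≥0 mΩ}
    {D : ℝ≥0 → Ω → ℝ} (hD : Adapted F D) (K : ℝ) (t : ℝ≥0) : Measurable[F t] (cutoff D K t) :=
  (hD t).indicator (measurableSet_boundedUpTo hD K t)

lemma abs_cutoff_le {Ω : Type*} {D : ℝ≥0 → Ω → ℝ} {K : ℝ} (hK : 0 ≤ K) (q : ℚ≥0) (ω : Ω) :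
    |cutoff D K q ω| ≤ K := by
  by_cases h : ω ∈ boundedUpTo D K q
  · rw [cutoff, Set.indicator_of_mem h]; exact h q le_rfl
  · rw [cutoff, Set.indicator_of_notMem h, abs_zero]; exact hK

lemma coe_rat_grid (q : ℚ≥0) (n i : ℕ) : ((q * i / n : ℚ≥0) : ℝ≥0) = grid q n i := by
  rw [grid]; push_cast; rfl

lemma memLp_cutoff {Ω : Type*} {mΩ : MeasurableSpace Ω} {F : Filtration ℝ≥0 mΩ} {P : Measure Ω}
    [IsProbabilityMeasure P] {D : ℝ≥0 → Ω → ℝ} (hD : Adapted F D) {K : ℝ} (hK : 0 ≤ K) (q : ℚ≥0) :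
    MemLp (cutoff D K q) 2 P :=
  MemLp.of_bound ((measurable_cutoff hD K q).mono (F.le _) le_rfl).aestronglyMeasurable K
    (ae_of_all _ fun ω => abs_cutoff_le hK q ω)

/-- Comparison of a Riemann sum of an exponential with its integral. -/
lemma sum_grid_exp_le {l : ℝ} (hl : 0 < l) (t : ℝ≥0) {n : ℕ} (hn : n ≠ 0) :
    ∑ i ∈ Finset.range n, ((t : ℝ) / n) * Real.exp (l * grid t n i) ≤ Real.exp (l * t) / l := by
  rw [le_div_iff₀ hl, Finset.sum_mul]
  calc _ ≤ ∑ i ∈ Finset.range n,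
        (Real.exp (l * grid t n (i + 1)) - Real.exp (l * grid t n i)) := by
        refine Finset.sum_le_sum fun i _ => ?_
        have h1 : l * (grid t n (i + 1) : ℝ) = l * grid t n i + l * (t / n) := by
          have := grid_succ_sub t n i
          rw [← this]; ring
        have h2 := Real.add_one_le_exp (l * ((t : ℝ) / n))
        rw [h1, Real.exp_add]
        nlinarith [Real.exp_pos (l * grid t n i)]
    _ = Real.exp (l * t) - 1 := by
        rw [Finset.sum_range_sub (fun i => Real.exp (l * grid t n i)), grid_self t hn, grid_zero]
        simp
    _ ≤ _ := by linarith

/-- Second moment bound for an Euler sum whose coefficients are cut off. -/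
lemma integral_sq_eulerSum_cutoff_le {Ω : Type*} {mΩ : MeasurableSpace Ω} {F : Filtration ℝ≥0 mΩ}
    {P : Measure Ω} [IsProbabilityMeasure P] {W D : ℝ≥0 → Ω → ℝ} (hW : IsBrownianMotionRel F P W)
    (hD : Adapted F D) {K : ℝ} (hK : 0 ≤ K) (μ α : ℝ) (q : ℚ≥0) {n : ℕ} (hn : n ≠ 0) :
    MemLp (eulerSum W μ α (cutoff D K) q n) 2 P ∧
    ∫ ω, eulerSum W μ α (cutoff D K) q n ω ^ 2 ∂P ≤
      2 * (μ ^ 2 * ((q : ℝ≥0) : ℝ) + α ^ 2) * ∑ i ∈ Finset.range n,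
        ((q : ℝ≥0) : ℝ) / n * ∫ ω, cutoff D K (grid q n i) ω ^ 2 ∂P := by
  set t : ℝ≥0 := (q : ℝ≥0) with ht
  let ζ : ℕ → Ω → ℝ := fun i => cutoff D K (grid t n i)
  have hζ2 : ∀ i, MemLp (ζ i) 2 P := fun i => by
    have := memLp_cutoff (P := P) hD hK (q * i / n)
    rwa [coe_rat_grid] at this
  obtain ⟨h1, h2⟩ := (hW.isInnovation (grid_mono t n) t).isometry (ζ := ζ)
    (fun j => measurable_cutoff hD K _) hζ2 n
  have hmin : ∀ i < n, min (grid t n i) t = grid t n i ∧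
      min (grid t n (i + 1)) t = grid t n (i + 1) := fun i hi =>
    ⟨min_eq_left (grid_le hi.le), min_eq_left (grid_le (Nat.succ_le_of_lt hi))⟩
  have h2' : ∫ ω, (∑ j ∈ Finset.range n, ζ j ω *
      (W (min (grid t n (j + 1)) t) ω - W (min (grid t n j) t) ω)) ^ 2 ∂P =
      ∑ i ∈ Finset.range n, (t : ℝ) / n * ∫ ω, ζ i ω ^ 2 ∂P := by
    rw [h2]
    refine Finset.sum_congr rfl fun i hi => ?_
    rw [(hmin i (Finset.mem_range.1 hi)).1, (hmin i (Finset.mem_range.1 hi)).2, grid_succ_sub,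
      mul_comm]
  have hdrift : MemLp (fun ω => ∑ i ∈ Finset.range n, ζ i ω) 2 P :=
    memLp_finsetSum _ fun i _ => hζ2 i
  have hdec : eulerSum W μ α (cutoff D K) t n = fun ω =>
      μ * ((t : ℝ) / n) * (∑ i ∈ Finset.range n, ζ i ω) + α * ∑ j ∈ Finset.range n, ζ j ω *
      (W (min (grid t n (j + 1)) t) ω - W (min (grid t n j) t) ω) := by
    ext ω
    rw [eulerSum, Finset.mul_sum, Finset.mul_sum, ← Finset.sum_add_distrib]
    refine Finset.sum_congr rfl fun i hi => ?_
    rw [(hmin i (Finset.mem_range.1 hi)).1, (hmin i (Finset.mem_range.1 hi)).2]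
    simp only [ζ]; ring
  have hmem : MemLp (eulerSum W μ α (cutoff D K) t n) 2 P := by
    rw [hdec]; exact (hdrift.const_mul _).add (h1.const_mul α)
  refine ⟨hmem, ?_⟩
  have hn' : (n : ℝ) ≠ 0 := Nat.cast_ne_zero.2 hn
  have i1 := hdrift.integrable_sq.const_mul (2 * (μ * ((t : ℝ) / n)) ^ 2)
  have i2 := h1.integrable_sq.const_mul (2 * α ^ 2)
  calc ∫ ω, eulerSum W μ α (cutoff D K) t n ω ^ 2 ∂P
      ≤ ∫ ω, 2 * (μ * ((t : ℝ) / n)) ^ 2 * (∑ i ∈ Finset.range n, ζ i ω) ^ 2 + 2 * α ^ 2 *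
        (∑ j ∈ Finset.range n, ζ j ω *
          (W (min (grid t n (j + 1)) t) ω - W (min (grid t n j) t) ω)) ^ 2 ∂P := by
        refine integral_mono hmem.integrable_sq (i1.add i2) fun ω => ?_
        simp only [hdec]
        refine (add_sq_le).trans (le_of_eq ?_)
        ring
    _ = 2 * (μ * ((t : ℝ) / n)) ^ 2 * ∫ ω, (∑ i ∈ Finset.range n, ζ i ω) ^ 2 ∂P +
        2 * α ^ 2 * ∑ i ∈ Finset.range n, (t : ℝ) / n * ∫ ω, ζ i ω ^ 2 ∂P := by
        rw [integral_add i1 i2, integral_const_mul, integral_const_mul, h2']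
    _ ≤ 2 * (μ * ((t : ℝ) / n)) ^ 2 * (n * ∑ i ∈ Finset.range n, ∫ ω, ζ i ω ^ 2 ∂P) +
        2 * α ^ 2 * ∑ i ∈ Finset.range n, (t : ℝ) / n * ∫ ω, ζ i ω ^ 2 ∂P := by
        gcongr
        rw [← integral_finsetSum _ fun i _ => (hζ2 i).integrable_sq, ← integral_const_mul]
        refine integral_mono hdrift.integrable_sq
          ((integrable_finsetSum _ fun i _ => (hζ2 i).integrable_sq).const_mul _) fun ω => ?_
        exact sq_sum_le_card_mul_sum_sq_range _ n
    _ = _ := by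
        rw [← Finset.mul_sum]
        simp only [ζ]
        field_simp

/-- If `D` solves the linear equation with zero initial value, the second moment of its cutoff at
time `q` is controlled by the earlier ones. -/
lemma integral_cutoff_sq_le {Ω : Type*} {mΩ : MeasurableSpace Ω} {F : Filtration ℝ≥0 mΩ}
    {P : Measure Ω} [IsProbabilityMeasure P] {W D : ℝ≥0 → Ω → ℝ} (hW : IsBrownianMotionRel F P W)
    (hD : Adapted F D) {μ α : ℝ} (q : ℚ≥0)
    (heq : TendstoInMeasure P (eulerSum W μ α D q) atTop (D q)) {K : ℝ} (hK : 0 ≤ K)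
    {M : ℝ} (hM : ∀ n : ℕ, n ≠ 0 → 2 * (μ ^ 2 * ((q : ℝ≥0) : ℝ) + α ^ 2) * ∑ i ∈ Finset.range n,
        ((q : ℝ≥0) : ℝ) / n * ∫ ω, cutoff D K (grid q n i) ω ^ 2 ∂P ≤ M) :
    ∫ ω, cutoff D K q ω ^ 2 ∂P ≤ M := by
  have hM0 : 0 ≤ M := le_trans (by positivity) (hM 1 one_ne_zero)
  obtain ⟨ns, hns, hlim⟩ := heq.exists_seq_tendsto_ae
  let f : ℕ → Ω → ℝ≥0∞ := fun k ω => ENNReal.ofReal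
    ((boundedUpTo D K q).indicator (eulerSum W μ α (cutoff D K) q (ns k)) ω ^ 2)
  have hA : MeasurableSet (boundedUpTo D K q) := F.le _ _ (measurableSet_boundedUpTo hD K q)
  have hcut : ∀ s, Measurable (cutoff D K s) := fun s =>
    (measurable_cutoff hD K s).mono (F.le s) le_rfl
  have hWm : ∀ s, Measurable (W s) := fun s => (hW.adapted s).mono (F.le s) le_rfl
  have hes : ∀ n, Measurable (eulerSum W μ α (cutoff D K) q n) := fun n =>
    Finset.measurable_fun_sum _ fun i _ =>
      (hcut _).mul ((((hWm _).sub (hWm _)).const_mul α).const_add _)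
  have hf : ∀ k, Measurable (f k) := fun k =>
    (((hes (ns k)).indicator hA).pow_const 2).ennreal_ofReal
  have hfl : ∀ᵐ ω ∂P, Tendsto (fun k => f k ω) atTop
      (𝓝 (ENNReal.ofReal (cutoff D K q ω ^ 2))) := by
    filter_upwards [hlim] with ω hω
    by_cases h : ω ∈ boundedUpTo D K q
    · have e : ∀ n, eulerSum W μ α (cutoff D K) q n ω = eulerSum W μ α D q n ω := by
        intro n
        refine Finset.sum_congr rfl fun i hi => ?_
        have : ω ∈ boundedUpTo D K (grid q n i) := fun r hr =>
          h r (hr.trans (grid_le (Finset.mem_range.1 hi).le))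
        rw [cutoff, Set.indicator_of_mem this]
      simp only [f, cutoff, Set.indicator_of_mem h]
      simp only [e]
      exact ENNReal.tendsto_ofReal (hω.pow 2)
    · simp only [f, cutoff, Set.indicator_of_notMem h]
      exact tendsto_const_nhds
  have hfM : ∀ᶠ k in atTop, ∫⁻ ω, f k ω ∂P ≤ ENNReal.ofReal M := by
    filter_upwards [eventually_ne_atTop 0] with k hk
    have hn : ns k ≠ 0 := by
      have := hns.le_apply (x := k)
      omega
    obtain ⟨h1, h2⟩ := integral_sq_eulerSum_cutoff_le hW hD hK μ α q hn
    calc _ ≤ ∫⁻ ω, ENNReal.ofReal (eulerSum W μ α (cutoff D K) q (ns k) ω ^ 2) ∂P := by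
          refine lintegral_mono fun ω => ENNReal.ofReal_le_ofReal ?_
          by_cases h : ω ∈ boundedUpTo D K q
          · rw [Set.indicator_of_mem h]
          · rw [Set.indicator_of_notMem h, zero_pow two_ne_zero]; exact sq_nonneg _
      _ = ENNReal.ofReal (∫ ω, eulerSum W μ α (cutoff D K) q (ns k) ω ^ 2 ∂P) :=
          (ofReal_integral_eq_lintegral_ofReal h1.integrable_sq
            (ae_of_all _ fun ω => sq_nonneg _)).symm
      _ ≤ _ := ENNReal.ofReal_le_ofReal (h2.trans (hM _ hn))
  have hfatou : ∫⁻ ω, ENNReal.ofReal (cutoff D K q ω ^ 2) ∂P ≤ ENNReal.ofReal M := by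
    calc _ = ∫⁻ ω, liminf (fun k => f k ω) atTop ∂P :=
          lintegral_congr_ae (hfl.mono fun ω h => h.liminf_eq.symm)
      _ ≤ liminf (fun k => ∫⁻ ω, f k ω ∂P) atTop := lintegral_liminf_le hf
      _ ≤ _ := liminf_le_of_frequently_le' hfM.frequently
  rw [← ofReal_integral_eq_lintegral_ofReal (memLp_cutoff hD hK q).integrable_sq
    (ae_of_all _ fun ω => sq_nonneg _)] at hfatou
  exact (ENNReal.ofReal_le_ofReal_iff hM0).1 hfatou

/-- A continuous adapted process which satisfies `dD = μ D dt + α D dW`, `D 0 = 0`, in the sense of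
Euler sums, vanishes at rational times. The proof is Grönwall's argument for the cutoffs, with
weights `exp (l q)` for a large `l`, for which the estimate is a contraction. -/
lemma ae_eq_zero_of_tendstoInMeasure_eulerSum {Ω : Type*} {mΩ : MeasurableSpace Ω}
    {F : Filtration ℝ≥0 mΩ} {P : Measure Ω} [IsProbabilityMeasure P] {W D : ℝ≥0 → Ω → ℝ}
    (hW : IsBrownianMotionRel F P W) (hD : Adapted F D)
    (hc : ∀ᵐ ω ∂P, Continuous fun s => D s ω) {μ α : ℝ}
    (heq : ∀ t, TendstoInMeasure P (eulerSum W μ α D t) atTop (D t)) (Q : ℚ≥0) :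
    ∀ᵐ ω ∂P, D Q ω = 0 := by
  have hcut : ∀ K : ℝ, 0 ≤ K → ∫ ω, cutoff D K Q ω ^ 2 ∂P = 0 := by
    intro K hK
    obtain ⟨c, hcdef⟩ : ∃ c : ℝ, c = 2 * (μ ^ 2 * ((Q : ℝ≥0) : ℝ) + α ^ 2) := ⟨_, rfl⟩
    obtain ⟨l, hldef⟩ : ∃ l : ℝ, l = 2 * c + 1 := ⟨_, rfl⟩
    have hc0 : 0 ≤ c := by rw [hcdef]; positivity
    have hl : 0 < l := by rw [hldef]; positivity
    have hiter : ∀ k : ℕ, ∀ q : ℚ≥0, q ≤ Q →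
        ∫ ω, cutoff D K q ω ^ 2 ∂P ≤ K ^ 2 * (1 / 2) ^ k * Real.exp (l * (q : ℝ≥0)) := by
      intro k
      induction k with
      | zero =>
        intro q _
        calc _ ≤ ∫ _, K ^ 2 ∂P := by
              refine integral_mono (memLp_cutoff hD hK q).integrable_sq (integrable_const _)
                fun ω => ?_
              exact sq_le_sq' (abs_le.1 (abs_cutoff_le hK q ω)).1
                (abs_le.1 (abs_cutoff_le hK q ω)).2
          _ = K ^ 2 := by simp
          _ ≤ _ := by
              rw [pow_zero, mul_one]
              exact le_mul_of_one_le_right (sq_nonneg K) (Real.one_le_exp (by positivity))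
      | succ k ih =>
        intro q hq
        refine integral_cutoff_sq_le hW hD q (heq q) hK fun n hn => ?_
        have hqQ : ((q : ℝ≥0) : ℝ) ≤ ((Q : ℝ≥0) : ℝ) := by exact_mod_cast hq
        calc _ ≤ c * ∑ i ∈ Finset.range n, ((q : ℝ≥0) : ℝ) / n *
              (K ^ 2 * (1 / 2) ^ k * Real.exp (l * grid q n i)) := by
              refine mul_le_mul ?_ (Finset.sum_le_sum fun i hi => ?_)
                (Finset.sum_nonneg fun i _ => mul_nonneg (by positivity)
                  (integral_nonneg fun ω => sq_nonneg _)) hc0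
              · rw [hcdef]; gcongr
              · have hle : q * i / n ≤ Q := by
                  have : ((q * i / n : ℚ≥0) : ℝ≥0) ≤ q := by
                    rw [coe_rat_grid]; exact grid_le (Finset.mem_range.1 hi).le
                  exact (by exact_mod_cast this : q * i / n ≤ q).trans hq
                have := ih _ hle
                rw [coe_rat_grid] at this
                gcongr
          _ = c * (K ^ 2 * (1 / 2) ^ k) *
              ∑ i ∈ Finset.range n, ((q : ℝ≥0) : ℝ) / n * Real.exp (l * grid q n i) := by
              simp only [Finset.mul_sum]
              exact Finset.sum_congr rfl fun i _ => by ring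
          _ ≤ c * (K ^ 2 * (1 / 2) ^ k) * (Real.exp (l * (q : ℝ≥0)) / l) := by
              gcongr
              exact sum_grid_exp_le hl q hn
          _ = (c / l) * (K ^ 2 * (1 / 2) ^ k * Real.exp (l * (q : ℝ≥0))) := by ring
          _ ≤ (1 / 2) * (K ^ 2 * (1 / 2) ^ k * Real.exp (l * (q : ℝ≥0))) := by
              refine mul_le_mul_of_nonneg_right ?_ (by positivity)
              rw [div_le_div_iff₀ hl two_pos]
              linarith
          _ = _ := by ring
    refine le_antisymm ?_ (integral_nonneg fun ω => sq_nonneg _)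
    have hlim : Tendsto (fun k : ℕ => K ^ 2 * (1 / 2 : ℝ) ^ k * Real.exp (l * (Q : ℝ≥0))) atTop
        (𝓝 (K ^ 2 * 0 * Real.exp (l * (Q : ℝ≥0)))) :=
      ((tendsto_pow_atTop_nhds_zero_of_lt_one (by norm_num) (by norm_num)).const_mul _).mul_const _
    rw [mul_zero, zero_mul] at hlim
    exact ge_of_tendsto' hlim fun k => hiter k Q le_rfl
  have hzero : ∀ᵐ ω ∂P, ∀ N : ℕ, cutoff D N Q ω = 0 := by
    rw [ae_all_iff]
    intro N
    have h := (integral_eq_zero_iff_of_nonneg (fun ω => sq_nonneg _)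
      (memLp_cutoff hD N.cast_nonneg Q).integrable_sq).1 (hcut N N.cast_nonneg)
    filter_upwards [h] with ω hω
    exact pow_eq_zero_iff two_ne_zero |>.1 hω
  filter_upwards [hzero, hc] with ω h1 h2
  obtain ⟨C, hC⟩ := (isCompact_Icc (a := (0 : ℝ≥0)) (b := Q)).exists_bound_of_continuousOn
    h2.continuousOn
  obtain ⟨N, hN⟩ := exists_nat_ge C
  have hmem : ω ∈ boundedUpTo D N Q := fun q hq => (hC _ ⟨zero_le, hq⟩).trans hN
  have := h1 N
  rwa [cutoff, Set.indicator_of_mem hmem] at this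

/-! ### Identification of the solution -/

/-- The solution of `dx = μ x dt + α x dW`, `x(0) = 1`, is geometric Brownian motion. -/
lemma IsSDESolution.ae_eq_gbm {Ω : Type*} {mΩ : MeasurableSpace Ω} {F : Filtration ℝ≥0 mΩ}
    {P : Measure Ω} [IsProbabilityMeasure P] {W x : ℝ≥0 → Ω → ℝ} (hW : IsBrownianMotionRel F P W)
    {μ α : ℝ} (hx : IsSDESolution F P W (fun y => μ * y) (fun y => α * y) 1 x) (q : ℚ≥0) :
    ∀ᵐ ω ∂P, x q ω = gbm W μ α q ω := by
  have hD : Adapted F fun s ω => x s ω - gbm W μ α s ω := fun s =>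
    Measurable.sub (hx.adapted s) (gbm_adapted hW.adapted μ α s)
  have hc : ∀ᵐ ω ∂P, Continuous fun s => x s ω - gbm W μ α s ω := by
    filter_upwards [hx.continuous_path, hW.isBrownian.cont] with ω h1 h2
    unfold gbm
    fun_prop
  have h0 : ∀ᵐ ω ∂P, gbm W μ α 0 ω = 1 := by
    filter_upwards [hW.isBrownian.toIsPreBrownianReal.eval_zero_ae_eq_zero] with ω hω
    simp [gbm, hω]
  have heq : ∀ t, TendstoInMeasure P (eulerSum W μ α (fun s ω => x s ω - gbm W μ α s ω) t) atTop
      (fun ω => x t ω - gbm W μ α t ω) := by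
    intro t
    refine TendstoInMeasure.congr (fun n => ae_of_all _ fun ω => ?_) ?_
      (tendstoInMeasure_add (hx.tendstoInMeasure_eulerSum hW t)
        (tendstoInMeasure_neg (tendstoInMeasure_eulerSum_gbm hW μ α t)))
    · simp only [eulerSum]
      rw [← Finset.sum_neg_distrib, ← Finset.sum_add_distrib]
      exact Finset.sum_congr rfl fun i _ => by ring
    · filter_upwards [h0] with ω hω
      rw [hω]; ring
  filter_upwards [ae_eq_zero_of_tendstoInMeasure_eulerSum hW hD hc heq q] with ω hω
  exact sub_eq_zero.1 hω

/-! ### The maximal inequality for the exponential martingale -/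

lemma gbm_zero_submartingale {Ω : Type*} {mΩ : MeasurableSpace Ω} {F : Filtration ℝ≥0 mΩ}
    {P : Measure Ω} [IsProbabilityMeasure P] {W : ℝ≥0 → Ω → ℝ} (hW : IsBrownianMotionRel F P W)
    (β : ℝ) {u : ℕ → ℝ≥0} (hu : Monotone u) :
    Submartingale (fun j => gbm W 0 β (u j)) (sampledFiltration F hu) P := by
  have hint : ∀ s, Integrable (gbm W 0 β s) P := fun s => (memLp_gbm hW 0 β s).integrable one_le_two
  refine submartingale_of_setIntegral_le_succ
    (fun j => (gbm_adapted hW.adapted 0 β (u j)).stronglyMeasurable) (fun j => hint _) ?_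
  intro j A hA
  have hle : u j ≤ u (j + 1) := hu (Nat.le_succ j)
  have hAm : MeasurableSet A := F.le _ _ hA
  let X : Ω → ℝ := A.indicator (gbm W 0 β (u j))
  let w : Ω → ℝ := fun ω => W (u (j + 1)) ω - W (u j) ω
  let N : Ω → ℝ := fun ω => gbmFactor 0 β ((u (j + 1) - u j : ℝ≥0) : ℝ) (w ω)
  have hX : Measurable[F (u j)] X := (gbm_adapted hW.adapted 0 β (u j)).indicator hA
  have hXi : AEStronglyMeasurable X P := ((hint _).indicator hAm).1
  have hNl := hW.hasLaw_sub hle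
  have hNi := (memLp_gbmFactor hNl 0 β).integrable one_le_two
  have hind : IndepFun X N P := by
    rw [IndepFun_iff_Indep]
    refine indep_of_indep_of_le_left ?_ hX.comap_le
    refine (indep_of_indep_of_le_left (hW.indep_increment _ _ hle) ?_).symm
    exact ((measurable_gbmFactor 0 β _).comp (comap_measurable w)).comap_le
  rw [← integral_indicator hAm, ← integral_indicator hAm]
  have e : A.indicator (gbm W 0 β (u (j + 1))) = fun ω => X ω * N ω := by
    ext ω
    by_cases h : ω ∈ A
    · simp only [X, N, w, Set.indicator_of_mem h, NNReal.coe_sub hle]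
      exact gbm_eq_mul W 0 β (u j) (u (j + 1)) ω
    · simp only [X, Set.indicator_of_notMem h, zero_mul]
  rw [e, hind.integral_fun_mul_eq_mul_integral hXi hNi.1, integral_gbmFactor hNl]
  simp [X]

/-- Doob's maximal inequality for the exponential martingale, over finitely many times. -/
lemma measure_exists_le_gbm_le {Ω : Type*} {mΩ : MeasurableSpace Ω} {F : Filtration ℝ≥0 mΩ}
    {P : Measure Ω} [IsProbabilityMeasure P] {W : ℝ≥0 → Ω → ℝ} (hW : IsBrownianMotionRel F P W)
    (β : ℝ) (c : ℝ≥0) (U : Finset ℝ≥0) :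
    P {ω | ∃ s ∈ U, (c : ℝ) ≤ gbm W 0 β s ω} ≤ (c : ℝ≥0∞)⁻¹ := by
  obtain ⟨u, m, hu, hum⟩ := exists_monotone_visiting U
  have hint : ∀ s, Integrable (gbm W 0 β s) P := fun s => (memLp_gbm hW 0 β s).integrable one_le_two
  have hpos : ∀ s ω, 0 ≤ gbm W 0 β s ω := fun s ω => (Real.exp_pos _).le
  have h := maximal_ineq (gbm_zero_submartingale hW β hu) (fun j ω => hpos _ ω) (ε := c) m
  have h1 : ENNReal.ofReal (∫ ω in {ω | (c : ℝ) ≤ (Finset.range (m + 1)).sup'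
      Finset.nonempty_range_add_one fun k => gbm W 0 β (u k) ω}, gbm W 0 β (u m) ω ∂P) ≤ 1 := by
    rw [← ENNReal.ofReal_one]
    refine ENNReal.ofReal_le_ofReal ?_
    refine (setIntegral_le_integral (hint _) (ae_of_all _ fun ω => hpos _ ω)).trans ?_
    rw [integral_gbm hW]
    simp
  rw [ENNReal.le_inv_iff_mul_le, mul_comm]
  refine le_trans ?_ (h.trans h1)
  gcongr
  rename_i ω
  rintro ⟨s, hs, hω⟩
  obtain ⟨a, ha, rfl⟩ := hum s hs
  exact (Finset.le_sup'_iff _).2 ⟨a, Finset.mem_range.2 (by omega), hω⟩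

lemma measure_exists_rat_le_gbm_le {Ω : Type*} {mΩ : MeasurableSpace Ω} {F : Filtration ℝ≥0 mΩ}
    {P : Measure Ω} [IsProbabilityMeasure P] {W : ℝ≥0 → Ω → ℝ} (hW : IsBrownianMotionRel F P W)
    (β : ℝ) (c : ℝ≥0) :
    P {ω | ∃ q : ℚ≥0, (c : ℝ) ≤ gbm W 0 β q ω} ≤ (c : ℝ≥0∞)⁻¹ := by
  obtain ⟨e, he⟩ := exists_surjective_nat ℚ≥0
  let f : ℕ → Set Ω := fun i => {ω | (c : ℝ) ≤ gbm W 0 β (e i) ω}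
  have hU : {ω | ∃ q : ℚ≥0, (c : ℝ) ≤ gbm W 0 β q ω} = ⋃ i, f i := by
    ext ω
    simp only [f, Set.mem_ofPred_eq, Set.mem_iUnion, he.exists]
  rw [hU]
  refine le_of_tendsto' (tendsto_measure_iUnion_accumulate (μ := P) (f := f)) fun n => ?_
  refine le_trans (measure_mono ?_)
    (measure_exists_le_gbm_le hW β c ((Finset.range (n + 1)).image fun i => (e i : ℝ≥0)))
  intro ω hω
  obtain ⟨i, hi, hω⟩ := Set.mem_accumulate.1 hω
  exact ⟨e i, Finset.mem_image_of_mem _ (Finset.mem_range.2 (by omega)), hω⟩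

/-- A suitable power of geometric Brownian motion is an exponential martingale. -/
lemma rpow_le_gbm_zero {Ω : Type*} {W : ℝ≥0 → Ω → ℝ} {μ α : ℝ} (hα : α ≠ 0)
    (hμ : μ < α ^ 2 / 2) {R : ℝ} (hR : 0 ≤ R) {t : ℝ≥0} {ω : Ω} (h : R ≤ gbm W μ α t ω) :
    R ^ (1 - 2 * μ / α ^ 2) ≤ gbm W 0 ((1 - 2 * μ / α ^ 2) * α) t ω := by
  have hα2 : 0 < α ^ 2 := by positivity
  have hγ : 0 ≤ 1 - 2 * μ / α ^ 2 := by
    rw [sub_nonneg, div_le_one hα2]; linarith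
  calc R ^ (1 - 2 * μ / α ^ 2) ≤ gbm W μ α t ω ^ (1 - 2 * μ / α ^ 2) :=
        Real.rpow_le_rpow hR h hγ
    _ = gbm W 0 ((1 - 2 * μ / α ^ 2) * α) t ω := by
        rw [gbm, gbm, ← Real.exp_mul]
        congr 1
        field_simp
        ring

/-! ### The probability of never exceeding a level -/

theorem lemma9p1 {Ω : Type*} {mΩ : MeasurableSpace Ω} (P : Measure Ω) [IsProbabilityMeasure P]
    (F : Filtration ℝ≥0 mΩ) (W : ℝ≥0 → Ω → ℝ)
    (hW : IsBrownianMotionRel F P W)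
    (μ α : ℝ) (hα : α ≠ 0) (hμ : μ < α ^ 2 / 2)
    (x : ℝ≥0 → Ω → ℝ)
    (hx : IsSDESolution F P W (fun y => μ * y) (fun y => α * y) 1 x)
    (R : ℝ) (hR : 1 < R) :
    1 - (1 / R) ^ (1 - 2 * μ / α ^ 2) ≤
      P.real {ω | hittingAfter x (Set.Ioi R) 0 ω = ⊤} := by
  have hR0 : 0 < R := one_pos.trans hR
  have hxm : ∀ s, Measurable (x s) := fun s => (hx.adapted s).mono (F.le s) le_rfl
  -- The event of never exceeding `R` need not be measurable, as paths are only almost surely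
  -- continuous; it is compared with the measurable event that refers to rational times.
  let B : Set Ω := {ω | ∃ q : ℚ≥0, R < x q ω}
  have hBm : MeasurableSet B := by
    have : B = ⋃ q : ℚ≥0, {ω | R < x q ω} := by ext ω; simp [B]
    rw [this]
    exact MeasurableSet.iUnion fun q => hxm q measurableSet_Ioi
  obtain ⟨c, hc⟩ : ∃ c : ℝ≥0, (c : ℝ) = R ^ (1 - 2 * μ / α ^ 2) :=
    ⟨⟨_, (Real.rpow_pos_of_pos hR0 _).le⟩, rfl⟩
  have hc0 : 0 < c := by
    rw [← NNReal.coe_pos, hc]; exact Real.rpow_pos_of_pos hR0 _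
  have hB : P.real B ≤ (1 / R) ^ (1 - 2 * μ / α ^ 2) := by
    rw [one_div, Real.inv_rpow hR0.le, ← hc, ← NNReal.coe_inv, measureReal_def]
    refine ENNReal.toReal_le_coe_of_le_coe ?_
    rw [ENNReal.coe_inv hc0.ne']
    refine (measure_mono_ae ?_).trans
      (measure_exists_rat_le_gbm_le hW ((1 - 2 * μ / α ^ 2) * α) c)
    filter_upwards [ae_all_iff.2 fun q => hx.ae_eq_gbm hW q] with ω hω
    rintro ⟨q, hq⟩
    rw [hω q] at hq
    exact ⟨q, hc ▸ rpow_le_gbm_zero hα hμ hR0.le hq.le⟩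
  -- by continuity a path which exceeds `R` does so at a rational time
  have hsub : P Bᶜ ≤ P {ω | hittingAfter x (Set.Ioi R) 0 ω = ⊤} := by
    refine measure_mono_ae ?_
    filter_upwards [hx.continuous_path] with ω hω hB
    refine hittingAfter_eq_top_iff.2 fun t _ ht => hB ?_
    obtain ⟨_, h1, q, rfl⟩ := denseRange_nnratCast.inter_open_nonempty _ (isOpen_Ioi.preimage hω) ⟨t, ht⟩
    exact ⟨q, h1⟩
  calc 1 - (1 / R) ^ (1 - 2 * μ / α ^ 2) ≤ 1 - P.real B := by linarith
    _ = P.real Bᶜ := (probReal_compl_eq_one_sub hBm).symm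
    _ ≤ _ := ENNReal.toReal_mono (measure_ne_top _ _) hsub
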